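/- **Setting.** For $A\in\mathbb R^{k\times n}$ and $W_\sharp\in\mathbb R^{m\times k}$ let $\mathcal L(W)=\frac1{2n}\|WA-W_\sharp A\|_F^2$ for $W\in\mathbb R^{m\times k}$, and let $B=\frac1nAA^\top$. Gradient descent is $W_0=0$, $W_{t+1}=W_t-\eta\nabla\mathcal L(W_t)$ with $\eta=\frac1{c\|B\|_{\rm op}}$. Write $\|\cdot\|_{\rm op},\|\cdot\|_F,\|\cdot\|_*$ for the operator, Frobenius and nuclear norms, and $\mathrm{nr}(G)=\|G\|_*^2/\|G\|_F^2$. Fix constants $0<c_1\le c_2$, $c\ge1$, $\ell,u>0$. For $d,r\in\mathbb N$ say that $B$ is *$(d,r)$-multi-spiked* if $B=S+\Sigma$ with $S,\Sigma\in\mathbb R^{k\times k}$ symmetric, $\operatorname{rank}S=r$, all nonzero eigenvalues of $S$ in $[c_1d^\ell,c_2d^u]$, $c_1I_k\preceq\Sigma\preceq c_2I_k$, and moreover $\|B\|_{\rm op}\ge c_1d^u$. **Theorem (multi-step gradient descent, realizable multi-spike model).** There is a constant $C_1>0$, depending only on $c_1,c_2,c,\ell,u$, such that for every constant $C_2>0$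 the following two statements hold. 1. For every $K$ there are constants $a,b>0$ such that for all sufficiently large $d$: for all $m,k,n,r$, every $A$ such that $B$ is $(d,r)$-multi-spiked, every $W_\sharp$ with $\|W_\sharp\|_{\rm op}\le K$, and every orthogonal $U$ with $B=U\operatorname{diag}(\lambda_1\ge\dots\ge\lambda_k)U^\top$, the matrix $\overline M\in\mathbb R^{m\times(k-r)}$ formed by the last $k-r$ columns of $W_\sharp U$ satisfies $$\|\nabla\mathcal L(W_t)\|_*\ \ge\ a\,\bigl(\|\overline M\|_*-r\bigr),\qquad \|\nabla\mathcal L(W_t)\|_F\ \le\ b\,\bigl(\|\overline M\|_F+\sqrt r\bigr)$$ for every integer $t$ with $C_1d^{u-\ell}\log d\le t\le C_2d^u$. 2. (Gaussian ground truth.) For all constants $0<\kappa_1\le\kappa_2$ there is a constant $C_3>0$ such that, in the regime $\kappa_1d\le m,k\le\kappa_2d$ and $r=o(d)$, if $B$ is $(d,r)$-multi-spiked and $W_\sharp$ has i.i.d. $\mathcal N(0,\frac1d)$ entries independent of $A$, then conditionally on $A$ (that is, for each fixed $A$, and uniformly over all such $A$), with probability tending to one as $d\to\infty$, $$\mathrm{nr}(\nabla\mathcal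 L(W_t))\ \ge\ C_3d\qquad\text{for all integers }t\text{ with } C_1d^{u-\ell}\log d\le t\le C_2d^u .$$ -/

import Mathlib

open Filter Topology MeasureTheory ProbabilityTheory
open scoped NNReal Matrix

noncomputable section

namespace MultiSpike

/-- Operator norm induced by the Euclidean norms. -/
def opNorm {m k : ℕ} (M : Matrix (Fin m) (Fin k) ℝ) : ℝ :=
  ‖(Matrix.toEuclideanLin M).toContinuousLinearMap‖

/-- Frobenius norm. -/
def frobNorm {p q : Type*} [Fintype p] [Fintype q] (M : Matrix p q ℝ) : ℝ :=
  √(∑ i, ∑ j, M i j ^ 2)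

/-- Nuclear norm: the sum of the singular values. (Mathlib's sequence of singular values of a
linear map is zero from the dimension of its domain on.) -/
def nucNorm {p q : Type*} [Fintype p] [Fintype q] [DecidableEq q] (M : Matrix p q ℝ) : ℝ :=
  ∑ i ∈ Finset.range (Fintype.card q), (Matrix.toEuclideanLin M).singularValues i

/-- Nuclear rank `‖G‖_*² / ‖G‖_F²`. -/
def nuclearRank {m k : ℕ} (G : Matrix (Fin m) (Fin k) ℝ) : ℝ :=
  nucNorm G ^ 2 / frobNorm G ^ 2

/-- The Gram matrix `B = (1/n) A Aᵀ`. -/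
def gram {k n : ℕ} (A : Matrix (Fin k) (Fin n) ℝ) : Matrix (Fin k) (Fin k) ℝ :=
  (1 / (n : ℝ)) • (A * Aᵀ)

/-- The loss `L(W) = (1/2n) ‖W A - Y‖_F²` with realizable labels `Y = W♯ A`. -/
def loss {m k n : ℕ} (A : Matrix (Fin k) (Fin n) ℝ) (Wsharp W : Matrix (Fin m) (Fin k) ℝ) : ℝ :=
  1 / (2 * (n : ℝ)) * frobNorm (W * A - Wsharp * A) ^ 2

/-- Gradient of a function of a matrix: the matrix of its partial derivatives. -/
def matGrad {m k : ℕ} (f : Matrix (Fin m) (Fin k) ℝ → ℝ) (W : Matrix (Fin m) (Fin k) ℝ) :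
    Matrix (Fin m) (Fin k) ℝ :=
  Matrix.of fun i j => deriv (fun s : ℝ => f (W + s • Matrix.single i j (1 : ℝ))) 0

/-- Gradient descent on `f` with step size `η`, started at the zero matrix. -/
def gdIter {m k : ℕ} (f : Matrix (Fin m) (Fin k) ℝ → ℝ) (η : ℝ) : ℕ → Matrix (Fin m) (Fin k) ℝ
  | 0 => 0
  | t + 1 => gdIter f η t - η • matGrad f (gdIter f η t)

/-- `∇L(W_t)` along gradient descent on the loss, with step size `η = 1 / (c ‖B‖_op)`. -/
def gradAt {m k n : ℕ} (c : ℝ) (A : Matrix (Fin k) (Fin n) ℝ) (Wsharp : Matrix (Fin m) (Fin k) ℝ)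
    (t : ℕ) : Matrix (Fin m) (Fin k) ℝ :=
  matGrad (loss A Wsharp) (gdIter (loss A Wsharp) (1 / (c * opNorm (gram A))) t)

/-- `B = S + Σ` with symmetric `S, Σ`, where `S` has rank `r` and its nonzero eigenvalues lie in
`[c₁ d^ℓ, c₂ d^u]`, and `c₁ I ≼ Σ ≼ c₂ I`. -/
def MultiSpiked (c₁ c₂ ℓ u : ℝ) (d r : ℕ) {k : ℕ} (B : Matrix (Fin k) (Fin k) ℝ) : Prop :=
  ∃ S Sig : Matrix (Fin k) (Fin k) ℝ,
    B = S + Sig ∧ S.IsSymm ∧ Sig.IsSymm ∧ S.rank = r ∧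
    (∀ μ ∈ spectrum ℝ S, μ ≠ 0 → c₁ * (d : ℝ) ^ ℓ ≤ μ ∧ μ ≤ c₂ * (d : ℝ) ^ u) ∧
    (Sig - c₁ • (1 : Matrix (Fin k) (Fin k) ℝ)).PosSemidef ∧
    (c₂ • (1 : Matrix (Fin k) (Fin k) ℝ) - Sig).PosSemidef

/-- `U` is an orthogonal factor in an eigenvalue decomposition `B = U diag(lam) Uᵀ` whose
eigenvalues are listed in decreasing order. -/
def IsOrderedEigenbasis {k : ℕ} (B U : Matrix (Fin k) (Fin k) ℝ) : Prop :=
  U ∈ Matrix.orthogonalGroup (Fin k) ℝ ∧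
    ∃ lam : Fin k → ℝ, Antitone lam ∧ B = U * Matrix.diagonal lam * Uᵀ

/-- All columns of `M` but the first `r`. -/
def lastCols {m k : ℕ} (r : ℕ) (M : Matrix (Fin m) (Fin k) ℝ) :
    Matrix (Fin m) {j : Fin k // r ≤ (j : ℕ)} ℝ :=
  M.submatrix id Subtype.val

/-- `C₁ d^(u-ℓ) log d ≤ t ≤ C₂ d^u`. -/
def InWindow (C₁ C₂ ℓ u : ℝ) (d t : ℕ) : Prop :=
  C₁ * (d : ℝ) ^ (u - ℓ) * Real.log d ≤ t ∧ (t : ℝ) ≤ C₂ * (d : ℝ) ^ u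

/-- The random matrix `W` has i.i.d. entries of law `N(0, v)`. -/
def IsGaussianMatrix {Ω : Type*} [MeasurableSpace Ω] (P : Measure Ω) {m k : ℕ} (v : ℝ≥0)
    (W : Ω → Matrix (Fin m) (Fin k) ℝ) : Prop :=
  (∀ i j, HasLaw (fun ω => W ω i j) (gaussianReal 0 v) P) ∧
    iIndepFun (fun (p : Fin m × Fin k) ω => W ω p.1 p.2) P

end MultiSpike

end

/-!
In an eigenbasis `U` of the Gram matrix, gradient descent multiplies the error along the eigenvalue
`λ` by `1 - ηλ` in each step, so `∇L(W_t) = -W♯ U diag(λ (1 - ηλ)^t) Uᵀ`. By Courant–Fischer the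
last `k - r` eigenvalues lie in `[c₁, c₂]`, and since `ηt = O(1)` in the window, their factors
`λ (1 - ηλ)^t` stay bounded above and below. The other `r` eigenvalues are at least `c₁ d^ℓ`, so
that `ηλt ≥ u log d` once `t ≥ C₁ d^(u-ℓ) log d`, and their factors drop to `λ d^(-u) = O(1)`. Hence
the gradient is comparable to the last `k - r` columns of `W♯ U`, up to a contribution of the first
`r` columns.

Hölder's inequality for the singular values of the gradient `G` gives
`‖G‖_F⁶ ≤ ‖G‖_*² ‖Gᵀ G‖_F²`. For `W♯` with independent entries of variance `v`, this reduces the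
bound on the nuclear rank to two concentration statements: the last columns of `W♯ U` have squared
Frobenius norm at least `mkv/2`, and `‖W♯ W♯ᵀ‖_F² ≤ 3 mk(m + k) v²`.
-/

noncomputable section

namespace MultiSpike

open scoped Matrix.Norms.L2Operator

section Frobenius

variable {p q r : Type*} [Fintype p] [Fintype q] [Fintype r]

theorem frobNorm_nonneg (M : Matrix p q ℝ) : 0 ≤ frobNorm M :=
  Real.sqrt_nonneg _

theorem frobNorm_sq (M : Matrix p q ℝ) : frobNorm M ^ 2 = ∑ i, ∑ j, M i j ^ 2 :=
  Real.sq_sqrt (Finset.sum_nonneg fun _ _ => Finset.sum_nonneg fun _ _ => sq_nonneg _)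

theorem transpose_mul_self_apply_self {q : Type*} (M : Matrix p q ℝ) (j : q) :
    (Mᵀ * M) j j = ∑ i, M i j ^ 2 := by
  simp only [Matrix.mul_apply, Matrix.transpose_apply, sq]

theorem mul_transpose_self_apply_self {n : Type*} (M : Matrix n p ℝ) (i : n) :
    (M * Mᵀ) i i = ∑ j, M i j ^ 2 :=
  transpose_mul_self_apply_self Mᵀ i

theorem trace_transpose_mul (M N : Matrix p q ℝ) :
    (Mᵀ * N).trace = ∑ j, ∑ i, M i j * N i j := by
  simp only [Matrix.trace, Matrix.diag_apply, Matrix.mul_apply, Matrix.transpose_apply]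

theorem frobNorm_sq_eq_trace (M : Matrix p q ℝ) : frobNorm M ^ 2 = (Mᵀ * M).trace := by
  simp only [frobNorm_sq, trace_transpose_mul, ← sq]
  exact Finset.sum_comm

theorem frobNorm_transpose (M : Matrix p q ℝ) : frobNorm Mᵀ = frobNorm M := by
  rw [frobNorm, frobNorm, Finset.sum_comm]
  rfl

theorem frobNorm_eq_of_transpose_mul_self {M : Matrix p q ℝ} {N : Matrix r q ℝ}
    (h : Mᵀ * M = Nᵀ * N) : frobNorm M = frobNorm N := by
  rw [← sq_eq_sq₀ (frobNorm_nonneg M) (frobNorm_nonneg N), frobNorm_sq_eq_trace,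
    frobNorm_sq_eq_trace, h]

theorem frobNorm_transpose_mul_self (M : Matrix p q ℝ) :
    frobNorm (Mᵀ * M) = frobNorm (M * Mᵀ) := by
  rw [← sq_eq_sq₀ (frobNorm_nonneg _) (frobNorm_nonneg _), frobNorm_sq_eq_trace,
    frobNorm_sq_eq_trace]
  simp only [Matrix.transpose_mul, Matrix.transpose_transpose]
  rw [Matrix.mul_assoc, Matrix.trace_mul_comm, Matrix.mul_assoc, Matrix.mul_assoc,
    Matrix.mul_assoc]

theorem sum_mulVec_sq_le [DecidableEq q] (M : Matrix p q ℝ) (v : q → ℝ) :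
    ∑ i, (M *ᵥ v) i ^ 2 ≤ ‖M‖ ^ 2 * ∑ j, v j ^ 2 := by
  have h := pow_le_pow_left₀ (norm_nonneg _) (M.l2_opNorm_mulVec (WithLp.toLp 2 v)) 2
  simpa [mul_pow, EuclideanSpace.real_norm_sq_eq] using h

theorem frobNorm_mul_le_norm_mul [DecidableEq q] (M : Matrix p q ℝ) (N : Matrix q r ℝ) :
    frobNorm (M * N) ≤ ‖M‖ * frobNorm N := by
  refine abs_le_of_sq_le_sq' ?_ (mul_nonneg (norm_nonneg M) (frobNorm_nonneg N)) |>.2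
  rw [mul_pow, frobNorm_sq, frobNorm_sq, Finset.sum_comm, Finset.sum_comm (γ := q), Finset.mul_sum]
  exact Finset.sum_le_sum fun j _ => sum_mulVec_sq_le M fun l => N l j

theorem norm_transpose [DecidableEq p] [DecidableEq q] (M : Matrix p q ℝ) : ‖Mᵀ‖ = ‖M‖ := by
  rw [← Matrix.conjTranspose_eq_transpose_of_trivial, Matrix.l2_opNorm_conjTranspose]

theorem frobNorm_mul_le_mul_norm [DecidableEq r] (M : Matrix p q ℝ) (N : Matrix q r ℝ) :
    frobNorm (M * N) ≤ frobNorm M * ‖N‖ := by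
  classical
  rw [← frobNorm_transpose, Matrix.transpose_mul, ← frobNorm_transpose M, ← norm_transpose N,
    mul_comm]
  exact frobNorm_mul_le_norm_mul Nᵀ Mᵀ

theorem transpose_mul_orthogonal [DecidableEq q] (V : Matrix.orthogonalGroup q ℝ) :
    (V : Matrix q q ℝ)ᵀ * (V : Matrix q q ℝ) = 1 :=
  (Matrix.mem_orthogonalGroup_iff' q ℝ).1 V.2

theorem orthogonal_mul_transpose [DecidableEq q] (V : Matrix.orthogonalGroup q ℝ) :
    (V : Matrix q q ℝ) * (V : Matrix q q ℝ)ᵀ = 1 :=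
  (Matrix.mem_orthogonalGroup_iff q ℝ).1 V.2

theorem frobNorm_mul_orthogonal [DecidableEq q] (M : Matrix p q ℝ)
    (V : Matrix.orthogonalGroup q ℝ) : frobNorm (M * (V : Matrix q q ℝ)) = frobNorm M := by
  rw [← frobNorm_transpose, ← frobNorm_transpose M]
  apply frobNorm_eq_of_transpose_mul_self
  rw [Matrix.transpose_transpose, Matrix.transpose_mul, Matrix.mul_assoc, ← Matrix.mul_assoc _ _ Mᵀ,
    orthogonal_mul_transpose, Matrix.one_mul, Matrix.transpose_transpose]

theorem sum_mul_orthogonal_sq_le [DecidableEq q] (M : Matrix p q ℝ)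
    (V : Matrix.orthogonalGroup q ℝ) (j : q) :
    ∑ i, (M * (V : Matrix q q ℝ)) i j ^ 2 ≤ ‖M‖ ^ 2 := by
  refine (sum_mulVec_sq_le M fun l => (V : Matrix q q ℝ) l j).trans_eq ?_
  rw [← transpose_mul_self_apply_self, transpose_mul_orthogonal, Matrix.one_apply_eq, mul_one]

theorem frobNorm_transpose_mul_self_mul_le [DecidableEq r] (M : Matrix p q ℝ) (E : Matrix q r ℝ) :
    frobNorm ((M * E)ᵀ * (M * E)) ≤ ‖E‖ ^ 2 * frobNorm (M * Mᵀ) := by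
  classical
  calc frobNorm ((M * E)ᵀ * (M * E)) = frobNorm (Eᵀ * (Mᵀ * M * E)) := by
        rw [Matrix.transpose_mul, Matrix.mul_assoc, Matrix.mul_assoc]
    _ ≤ ‖E‖ * (frobNorm (Mᵀ * M) * ‖E‖) := by
        refine (frobNorm_mul_le_norm_mul _ _).trans ?_
        rw [norm_transpose]
        gcongr
        exact frobNorm_mul_le_mul_norm _ _
    _ = ‖E‖ ^ 2 * frobNorm (M * Mᵀ) := by
        rw [frobNorm_transpose_mul_self]
        ring

end Frobenius

section ConjDiagonal

variable {q : Type*} [Fintype q] [DecidableEq q]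

/-- The algebra of the matrices `V diag(f) Vᵀ` with a fixed orthonormal eigenbasis `V`, as the
image of the functions `f` on the index set. -/
def conjDiagonal (V : Matrix.orthogonalGroup q ℝ) : (q → ℝ) →ₐ[ℝ] Matrix q q ℝ :=
  (Unitary.conjStarAlgAut ℝ (Matrix q q ℝ) V : Matrix q q ℝ →ₐ[ℝ] Matrix q q ℝ).comp
    (Matrix.diagonalAlgHom ℝ)

variable (V : Matrix.orthogonalGroup q ℝ) (f : q → ℝ)

theorem conjDiagonal_apply :
    conjDiagonal V f = (V : Matrix q q ℝ) * Matrix.diagonal f * (V : Matrix q q ℝ)ᵀ :=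
  rfl

theorem transpose_conjDiagonal : (conjDiagonal V f)ᵀ = conjDiagonal V f := by
  simp only [conjDiagonal_apply, Matrix.transpose_mul, Matrix.transpose_transpose,
    Matrix.diagonal_transpose, Matrix.mul_assoc]

theorem conjDiagonal_mul_orthogonal :
    conjDiagonal V f * (V : Matrix q q ℝ) = (V : Matrix q q ℝ) * Matrix.diagonal f := by
  rw [conjDiagonal_apply, Matrix.mul_assoc, transpose_mul_orthogonal, Matrix.mul_one]

theorem trace_conjDiagonal : (conjDiagonal V f).trace = ∑ i, f i := by
  rw [conjDiagonal_apply, Matrix.trace_mul_comm, ← Matrix.mul_assoc,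
    transpose_mul_orthogonal, Matrix.one_mul, Matrix.trace_diagonal]

theorem norm_conjDiagonal : ‖conjDiagonal V f‖ = ‖f‖ := by
  have hVt : (V : Matrix q q ℝ)ᵀ ∈ unitary (Matrix q q ℝ) := Unitary.star_mem V.2
  rw [conjDiagonal_apply, CStarRing.norm_mul_mem_unitary _ hVt,
    CStarRing.norm_mem_unitary_mul _ V.2, Matrix.l2_opNorm_diagonal]

theorem dotProduct_conjDiagonal_mulVec (v : q → ℝ) :
    v ⬝ᵥ (conjDiagonal V f *ᵥ v) = ∑ i, f i * ((V : Matrix q q ℝ)ᵀ *ᵥ v) i ^ 2 := by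
  rw [conjDiagonal_apply, ← Matrix.mulVec_mulVec, ← Matrix.mulVec_mulVec, Matrix.dotProduct_mulVec,
    ← Matrix.mulVec_transpose]
  simp only [dotProduct, Matrix.mulVec_diagonal]
  exact Finset.sum_congr rfl fun i _ => by ring

theorem dotProduct_self_eq_sum_transpose_mulVec_sq (v : q → ℝ) :
    v ⬝ᵥ v = ∑ i, ((V : Matrix q q ℝ)ᵀ *ᵥ v) i ^ 2 := by
  simpa using dotProduct_conjDiagonal_mulVec V 1 v

theorem eq_conjDiagonal {B : Matrix q q ℝ} (hB : B.IsHermitian) :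
    B = conjDiagonal hB.eigenvectorUnitary hB.eigenvalues :=
  hB.spectral_theorem

end ConjDiagonal

section NuclearNorm

variable {p q r : Type*} [Fintype p] [Fintype q] [Fintype r] [DecidableEq q] [DecidableEq r]

theorem nucNorm_nonneg (M : Matrix p q ℝ) : 0 ≤ nucNorm M :=
  Finset.sum_nonneg fun i _ => LinearMap.singularValues_nonneg _ i

theorem nucNorm_eq_sum_sqrt_eigenvalues (M : Matrix p q ℝ) (hM : (Mᵀ * M).IsHermitian) :
    nucNorm M = ∑ i, √(hM.eigenvalues i) := by
  have hadj : Matrix.toEuclideanLin (Mᵀ * M) =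
      (Matrix.toEuclideanLin M).adjoint ∘ₗ Matrix.toEuclideanLin M := by
    classical
    rw [← Matrix.toEuclideanLin_conjTranspose_eq_adjoint]
    ext v i
    simp [Matrix.toLpLin_apply, Matrix.mulVec_mulVec]
  have hrank : Module.finrank ℝ (EuclideanSpace ℝ q) = Fintype.card q := finrank_euclideanSpace
  have hsing (i : Fin (Fintype.card q)) :
      (Matrix.toEuclideanLin M).singularValues i = √(hM.eigenvalues₀ i) := by
    rw [LinearMap.singularValues_fin _ hrank, Matrix.IsHermitian.eigenvalues₀]
    simp only [hadj]
  simp only [nucNorm, Finset.sum_range, hsing]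
  exact (Equiv.sum_comp (Fintype.equivOfCardEq (Fintype.card_fin _)).symm
    (fun i => √(hM.eigenvalues₀ i))).symm

theorem exists_right_singular_basis (M : Matrix p q ℝ) :
    ∃ (V : Matrix.orthogonalGroup q ℝ) (s : q → ℝ), (∀ i, 0 ≤ s i) ∧
      Mᵀ * M = conjDiagonal V (s ^ 2) ∧ nucNorm M = ∑ i, s i := by
  have hpos : (Mᵀ * M).PosSemidef := by
    simpa using Matrix.posSemidef_conjTranspose_mul_self M
  refine ⟨hpos.1.eigenvectorUnitary, fun i => √(hpos.1.eigenvalues i),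
    fun i => Real.sqrt_nonneg _, ?_, nucNorm_eq_sum_sqrt_eigenvalues M hpos.1⟩
  rw [show (fun i => √(hpos.1.eigenvalues i)) ^ 2 = hpos.1.eigenvalues from
    funext fun i => Real.sq_sqrt (hpos.eigenvalues_nonneg i)]
  exact hpos.1.spectral_theorem

theorem sum_mul_orthogonal_sq {M : Matrix p q ℝ} {V : Matrix.orthogonalGroup q ℝ} {s : q → ℝ}
    (hM : Mᵀ * M = conjDiagonal V (s ^ 2)) (i : q) :
    ∑ a, (M * (V : Matrix q q ℝ)) a i ^ 2 = s i ^ 2 := by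
  rw [← transpose_mul_self_apply_self, Matrix.transpose_mul, Matrix.mul_assoc,
    ← Matrix.mul_assoc Mᵀ, hM, conjDiagonal_mul_orthogonal, ← Matrix.mul_assoc,
    transpose_mul_orthogonal, Matrix.one_mul, Matrix.diagonal_apply_eq, Pi.pow_apply]

theorem trace_transpose_mul_le_norm_mul_nucNorm (M Y : Matrix p q ℝ) :
    (Mᵀ * Y).trace ≤ ‖Y‖ * nucNorm M := by
  obtain ⟨V, s, hs, hM, hnuc⟩ := exists_right_singular_basis M
  calc (Mᵀ * Y).trace
      = ((M * (V : Matrix q q ℝ))ᵀ * (Y * (V : Matrix q q ℝ))).trace := by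
        rw [Matrix.trace_mul_comm _ (Y * _), Matrix.mul_assoc, Matrix.transpose_mul,
          ← Matrix.mul_assoc (V : Matrix q q ℝ), orthogonal_mul_transpose, Matrix.one_mul,
          Matrix.trace_mul_comm]
    _ = ∑ i, ∑ a, (M * (V : Matrix q q ℝ)) a i * (Y * (V : Matrix q q ℝ)) a i :=
        trace_transpose_mul _ _
    _ ≤ ∑ i, s i * ‖Y‖ := by
        refine Finset.sum_le_sum fun i _ => (Real.sum_mul_le_sqrt_mul_sqrt _ _ _).trans ?_
        rw [sum_mul_orthogonal_sq hM, Real.sqrt_sq (hs i)]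
        exact mul_le_mul_of_nonneg_left (Real.sqrt_le_iff.2
          ⟨norm_nonneg Y, sum_mul_orthogonal_sq_le Y V i⟩) (hs i)
    _ = ‖Y‖ * nucNorm M := by rw [hnuc, ← Finset.sum_mul, mul_comm]

theorem exists_norm_le_one_trace_eq_nucNorm (M : Matrix p q ℝ) :
    ∃ Y : Matrix p q ℝ, ‖Y‖ ≤ 1 ∧ (Mᵀ * Y).trace = nucNorm M := by
  obtain ⟨V, s, -, hM, hnuc⟩ := exists_right_singular_basis M
  refine ⟨M * conjDiagonal V s⁻¹, ?_, ?_⟩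
  · have hsq : (M * conjDiagonal V s⁻¹)ᴴ * (M * conjDiagonal V s⁻¹) =
        conjDiagonal V (s⁻¹ * s ^ 2 * s⁻¹) := by
      rw [Matrix.conjTranspose_eq_transpose_of_trivial, Matrix.transpose_mul,
        transpose_conjDiagonal, Matrix.mul_assoc, ← Matrix.mul_assoc Mᵀ, hM, map_mul, map_mul,
        Matrix.mul_assoc]
    have hle : ‖s⁻¹ * s ^ 2 * s⁻¹‖ ≤ 1 := (pi_norm_le_iff_of_nonneg zero_le_one).2 fun i => by
      rcases eq_or_ne (s i) 0 with h | h
      · simp [h]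
      · simp [field]
    rw [← abs_norm, abs_le_one_iff_mul_self_le_one, ← Matrix.l2_opNorm_conjTranspose_mul_self,
      hsq, norm_conjDiagonal]
    exact hle
  · rw [← Matrix.mul_assoc, hM, ← map_mul, trace_conjDiagonal, hnuc]
    refine Finset.sum_congr rfl fun i _ => ?_
    rcases eq_or_ne (s i) 0 with h | h
    · simp [h]
    · simp [field]

theorem nucNorm_mul_le (X : Matrix p q ℝ) (E : Matrix q r ℝ) :
    nucNorm (X * E) ≤ nucNorm X * ‖E‖ := by
  obtain ⟨Y, hY, htrace⟩ := exists_norm_le_one_trace_eq_nucNorm (X * E)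
  have hX := nucNorm_nonneg X
  calc nucNorm (X * E) = (Xᵀ * (Y * Eᵀ)).trace := by
        rw [← htrace, Matrix.transpose_mul, Matrix.mul_assoc, Matrix.trace_mul_comm,
          Matrix.mul_assoc]
    _ ≤ ‖Y * Eᵀ‖ * nucNorm X := trace_transpose_mul_le_norm_mul_nucNorm X _
    _ ≤ (1 * ‖E‖) * nucNorm X := by
        gcongr
        rw [← norm_transpose E]
        exact (Matrix.l2_opNorm_mul Y Eᵀ).trans (by gcongr)
    _ = nucNorm X * ‖E‖ := by ring

end NuclearNorm

section NuclearRank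

theorem sum_sq_pow_three_le {ι : Type*} (t : Finset ι) {s : ι → ℝ} (hs : ∀ i ∈ t, 0 ≤ s i) :
    (∑ i ∈ t, s i ^ 2) ^ 3 ≤ (∑ i ∈ t, s i) ^ 2 * ∑ i ∈ t, s i ^ 4 := by
  have h13 : (∑ i ∈ t, s i ^ 2) ^ 2 ≤ (∑ i ∈ t, s i) * ∑ i ∈ t, s i ^ 3 :=
    Finset.sum_sq_le_sum_mul_sum_of_sq_le_mul _ hs (fun i hi => pow_nonneg (hs i hi) 3)
      fun i _ => (by ring : _ = _).le
  have h24 : (∑ i ∈ t, s i ^ 3) ^ 2 ≤ (∑ i ∈ t, s i ^ 2) * ∑ i ∈ t, s i ^ 4 :=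
    Finset.sum_sq_le_sum_mul_sum_of_sq_le_mul _ (fun i _ => sq_nonneg _)
      (fun i hi => pow_nonneg (hs i hi) 4) fun i _ => (by ring : _ = _).le
  rcases (Finset.sum_nonneg fun i _ => sq_nonneg (s i) : 0 ≤ ∑ i ∈ t, s i ^ 2).eq_or_lt with h | h
  · rw [← h, zero_pow three_ne_zero]
    exact mul_nonneg (sq_nonneg _) (Finset.sum_nonneg fun i hi => pow_nonneg (hs i hi) 4)
  · refine le_of_mul_le_mul_left ?_ h
    calc (∑ i ∈ t, s i ^ 2) * (∑ i ∈ t, s i ^ 2) ^ 3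
        = ((∑ i ∈ t, s i ^ 2) ^ 2) ^ 2 := by ring
      _ ≤ ((∑ i ∈ t, s i) * ∑ i ∈ t, s i ^ 3) ^ 2 := by gcongr
      _ = (∑ i ∈ t, s i) ^ 2 * (∑ i ∈ t, s i ^ 3) ^ 2 := mul_pow _ _ _
      _ ≤ (∑ i ∈ t, s i) ^ 2 * ((∑ i ∈ t, s i ^ 2) * ∑ i ∈ t, s i ^ 4) := by gcongr
      _ = (∑ i ∈ t, s i ^ 2) * ((∑ i ∈ t, s i) ^ 2 * ∑ i ∈ t, s i ^ 4) := by ring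

theorem frobNorm_pow_six_le {p q : Type*} [Fintype p] [Fintype q] [DecidableEq q]
    (M : Matrix p q ℝ) :
    (frobNorm M ^ 2) ^ 3 ≤ nucNorm M ^ 2 * frobNorm (Mᵀ * M) ^ 2 := by
  obtain ⟨V, s, hs, hM, hnuc⟩ := exists_right_singular_basis M
  rw [frobNorm_sq_eq_trace (Mᵀ * M), frobNorm_sq_eq_trace M, hM, transpose_conjDiagonal, ← map_mul,
    ← pow_add, trace_conjDiagonal, trace_conjDiagonal, hnuc]
  exact sum_sq_pow_three_le _ fun i _ => hs i

theorem div_le_nuclearRank {m k : ℕ} {G : Matrix (Fin m) (Fin k) ℝ} {x y : ℝ} (hx : 0 < x)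
    (hF : x ≤ frobNorm G ^ 2) (hgram : frobNorm (Gᵀ * G) ^ 2 ≤ y) :
    x ^ 2 / y ≤ nuclearRank G := by
  have hsix := frobNorm_pow_six_le G
  have hFpos : 0 < frobNorm G ^ 2 := hx.trans_le hF
  have hgram_pos : 0 < frobNorm (Gᵀ * G) ^ 2 :=
    pos_of_mul_pos_right ((pow_pos hFpos 3).trans_le hsix) (sq_nonneg _)
  rw [nuclearRank, div_le_div_iff₀ (hgram_pos.trans_le hgram) hFpos]
  calc x ^ 2 * frobNorm G ^ 2 ≤ (frobNorm G ^ 2) ^ 2 * frobNorm G ^ 2 := by gcongr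
    _ = (frobNorm G ^ 2) ^ 3 := by ring
    _ ≤ nucNorm G ^ 2 * frobNorm (Gᵀ * G) ^ 2 := hsix
    _ ≤ nucNorm G ^ 2 * y := by gcongr

end NuclearRank

section Gradient

theorem hasDerivAt_frobNorm_add_smul_sq {p q : Type*} [Fintype p] [Fintype q]
    (R H : Matrix p q ℝ) :
    HasDerivAt (fun s : ℝ => frobNorm (R + s • H) ^ 2) (2 * (Rᵀ * H).trace) 0 := by
  simp only [frobNorm_sq, trace_transpose_mul, Finset.mul_sum]
  rw [Finset.sum_comm]
  refine HasDerivAt.fun_sum fun i _ => HasDerivAt.fun_sum fun j _ => ?_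
  refine ((((hasDerivAt_id (0 : ℝ)).mul_const (H i j)).const_add (R i j)).pow 2).congr_deriv ?_
  simp [mul_assoc]

variable {m k n : ℕ}

theorem hasDerivAt_loss_add_smul (A : Matrix (Fin k) (Fin n) ℝ)
    (Wsharp W H : Matrix (Fin m) (Fin k) ℝ) :
    HasDerivAt (fun s : ℝ => loss A Wsharp (W + s • H)) (((W - Wsharp) * gram A)ᵀ * H).trace 0 := by
  have hexp (s : ℝ) : (W + s • H) * A - Wsharp * A = (W - Wsharp) * A + s • (H * A) := by
    rw [Matrix.add_mul, Matrix.smul_mul, Matrix.sub_mul]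
    abel
  simp only [loss, hexp]
  refine ((hasDerivAt_frobNorm_add_smul_sq _ _).const_mul _).congr_deriv ?_
  rw [← mul_assoc, show 1 / (2 * (n : ℝ)) * 2 = 1 / n by field_simp, gram, Matrix.mul_smul,
    Matrix.transpose_smul, Matrix.smul_mul, Matrix.trace_smul, smul_eq_mul, Matrix.trace_mul_comm,
    Matrix.mul_assoc, Matrix.trace_mul_comm, ← Matrix.mul_assoc (W - Wsharp),
    Matrix.transpose_mul _ Aᵀ, Matrix.transpose_transpose, Matrix.mul_assoc]

theorem matGrad_loss (A : Matrix (Fin k) (Fin n) ℝ) (Wsharp W : Matrix (Fin m) (Fin k) ℝ) :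
    matGrad (loss A Wsharp) W = (W - Wsharp) * gram A := by
  ext i j
  rw [matGrad, Matrix.of_apply, (hasDerivAt_loss_add_smul A Wsharp W _).deriv,
    Matrix.trace_mul_single]
  simp

theorem gdIter_loss_sub (A : Matrix (Fin k) (Fin n) ℝ) (Wsharp : Matrix (Fin m) (Fin k) ℝ)
    (η : ℝ) (t : ℕ) :
    gdIter (loss A Wsharp) η t - Wsharp = -(Wsharp * (1 - η • gram A) ^ t) := by
  induction t with
  | zero => simp [gdIter]
  | succ t ih =>
    rw [gdIter, matGrad_loss, sub_right_comm, ih, pow_succ, ← Matrix.mul_assoc]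
    simp only [Matrix.mul_sub, Matrix.mul_one, Matrix.mul_smul, Matrix.neg_mul, smul_neg]
    abel

/-- The factor by which `t` steps of gradient descent with step size `η`, followed by taking the
gradient, act on the eigenspace of the Gram matrix for the eigenvalue `x`, up to sign. -/
def gdFilter (η : ℝ) (t : ℕ) (x : ℝ) : ℝ :=
  (1 - η * x) ^ t * x

theorem gradAt_eq_mul_conjDiagonal (c : ℝ) {A : Matrix (Fin k) (Fin n) ℝ}
    (Wsharp : Matrix (Fin m) (Fin k) ℝ) (t : ℕ) {U : Matrix.orthogonalGroup (Fin k) ℝ}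
    {lam : Fin k → ℝ} (hA : gram A = conjDiagonal U lam) :
    gradAt c A Wsharp t =
      Wsharp * conjDiagonal U fun j => -gdFilter (1 / (c * opNorm (gram A))) t (lam j) := by
  rw [gradAt, matGrad_loss, gdIter_loss_sub]
  generalize 1 / (c * opNorm (gram A)) = η
  have hfilter : (fun j => -gdFilter η t (lam j)) = -((1 - η • lam) ^ t * lam) := rfl
  rw [hA, hfilter, map_neg, map_mul, map_pow, map_sub, map_one, map_smul, Matrix.neg_mul,
    Matrix.mul_neg, Matrix.mul_assoc]

end Gradient

section CourantFischer

theorem exists_mem_ne_zero_mulVec_eq_zero {p q : Type*} [Fintype q] (M : Matrix p q ℝ)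
    (V : Submodule ℝ (q → ℝ)) (s : Finset p) (hs : s.card < Module.finrank ℝ V) :
    ∃ x ∈ V, x ≠ 0 ∧ ∀ i ∈ s, (M *ᵥ x) i = 0 := by
  let f : V →ₗ[ℝ] (s → ℝ) := LinearMap.funLeft ℝ ℝ Subtype.val ∘ₗ M.mulVecLin ∘ₗ V.subtype
  have hf : LinearMap.ker f ≠ ⊥ := LinearMap.ker_ne_bot_of_finrank_lt (by simpa using hs)
  obtain ⟨x, hx, hx0⟩ := Submodule.exists_mem_ne_zero_of_ne_bot hf
  exact ⟨x, x.2, fun h => hx0 (Subtype.ext h), fun i hi => congrFun hx ⟨i, hi⟩⟩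

theorem dotProduct_self_pos {q : Type*} [Fintype q] {x : q → ℝ} (hx : x ≠ 0) : 0 < x ⬝ᵥ x :=
  Matrix.dotProduct_star_self_pos_iff.2 hx

variable {k : ℕ} {U : Matrix.orthogonalGroup (Fin k) ℝ} {lam : Fin k → ℝ} (hlam : Antitone lam)
  {b : ℝ} {j : Fin k} (V : Submodule ℝ (Fin k → ℝ))
include hlam

theorem eigenvalue_le_of_forall_mem (hV : k ≤ Module.finrank ℝ V + j)
    (hb : ∀ x ∈ V, x ⬝ᵥ (conjDiagonal U lam *ᵥ x) ≤ b * (x ⬝ᵥ x)) : lam j ≤ b := by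
  have hcard : (Finset.Ioi j).card < Module.finrank ℝ V := by
    rw [Fin.card_Ioi]
    omega
  obtain ⟨x, hxV, hx, hzero⟩ := exists_mem_ne_zero_mulVec_eq_zero (U : Matrix _ _ ℝ)ᵀ V _ hcard
  refine le_of_mul_le_mul_right (le_trans ?_ (hb x hxV)) (dotProduct_self_pos hx)
  rw [dotProduct_conjDiagonal_mulVec, dotProduct_self_eq_sum_transpose_mulVec_sq U, Finset.mul_sum]
  refine Finset.sum_le_sum fun i _ => ?_
  rcases le_or_gt i j with hij | hij
  · exact mul_le_mul_of_nonneg_right (hlam hij) (sq_nonneg _)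
  · simp [hzero i (Finset.mem_Ioi.2 hij)]

theorem le_eigenvalue_of_forall_mem (hV : j < Module.finrank ℝ V)
    (hb : ∀ x ∈ V, b * (x ⬝ᵥ x) ≤ x ⬝ᵥ (conjDiagonal U lam *ᵥ x)) : b ≤ lam j := by
  have hcard : (Finset.Iio j).card < Module.finrank ℝ V := by rwa [Fin.card_Iio]
  obtain ⟨x, hxV, hx, hzero⟩ := exists_mem_ne_zero_mulVec_eq_zero (U : Matrix _ _ ℝ)ᵀ V _ hcard
  refine le_of_mul_le_mul_right ((hb x hxV).trans ?_) (dotProduct_self_pos hx)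
  rw [dotProduct_conjDiagonal_mulVec, dotProduct_self_eq_sum_transpose_mulVec_sq U, Finset.mul_sum]
  refine Finset.sum_le_sum fun i _ => ?_
  rcases le_or_gt j i with hij | hij
  · exact mul_le_mul_of_nonneg_right (hlam hij) (sq_nonneg _)
  · simp [hzero i (Finset.mem_Iio.2 hij)]

end CourantFischer

section Spectrum

variable {q : Type*} [Fintype q] [DecidableEq q]

theorem dotProduct_mulVec_le_of_spectrum_le {S : Matrix q q ℝ} (hS : S.IsHermitian) {b : ℝ}
    (hb : ∀ μ ∈ spectrum ℝ S, μ ≤ b) (v : q → ℝ) : v ⬝ᵥ (S *ᵥ v) ≤ b * (v ⬝ᵥ v) := by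
  rw [congrArg (fun T => v ⬝ᵥ (T *ᵥ v)) (eq_conjDiagonal hS), dotProduct_conjDiagonal_mulVec,
    dotProduct_self_eq_sum_transpose_mulVec_sq hS.eigenvectorUnitary, Finset.mul_sum]
  exact Finset.sum_le_sum fun i _ =>
    mul_le_mul_of_nonneg_right (hb _ (hS.eigenvalues_mem_spectrum_real i)) (sq_nonneg _)

theorem le_dotProduct_mulVec_of_mem_range {S : Matrix q q ℝ} (hS : S.IsHermitian) {a : ℝ}
    (ha : ∀ μ ∈ spectrum ℝ S, μ ≠ 0 → a ≤ μ) {v : q → ℝ} (hv : v ∈ S.mulVecLin.range) :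
    a * (v ⬝ᵥ v) ≤ v ⬝ᵥ (S *ᵥ v) := by
  set V := hS.eigenvectorUnitary
  obtain ⟨w, rfl⟩ := hv
  have hcoord (i : q) : ((V : Matrix q q ℝ)ᵀ *ᵥ (S *ᵥ w)) i =
      hS.eigenvalues i * ((V : Matrix q q ℝ)ᵀ *ᵥ w) i := by
    rw [congrArg (· *ᵥ w) (eq_conjDiagonal hS), conjDiagonal_apply, Matrix.mulVec_mulVec,
      ← Matrix.mul_assoc, ← Matrix.mul_assoc, transpose_mul_orthogonal, Matrix.one_mul,
      ← Matrix.mulVec_mulVec, Matrix.mulVec_diagonal]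
  rw [congrArg (fun T => _ ⬝ᵥ (T *ᵥ _)) (eq_conjDiagonal hS), dotProduct_conjDiagonal_mulVec,
    dotProduct_self_eq_sum_transpose_mulVec_sq V, Finset.mul_sum]
  refine Finset.sum_le_sum fun i _ => ?_
  rcases eq_or_ne (hS.eigenvalues i) 0 with h0 | h0
  · simp [hcoord, h0]
  · exact mul_le_mul_of_nonneg_right (ha _ (hS.eigenvalues_mem_spectrum_real i) h0) (sq_nonneg _)

variable {k : ℕ} {c₁ c₂ ℓ u : ℝ} {d r : ℕ}

theorem MultiSpiked.exists_rank_eq_forall_dotProduct_bounds (hc₁ : 0 ≤ c₁) (hc₂ : 0 ≤ c₂)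
    {B : Matrix (Fin k) (Fin k) ℝ} (hB : MultiSpiked c₁ c₂ ℓ u d r B) :
    ∃ S : Matrix (Fin k) (Fin k) ℝ, S.rank = r ∧
      (∀ v, c₁ * (v ⬝ᵥ v) ≤ v ⬝ᵥ (B *ᵥ v)) ∧
      (∀ v, v ⬝ᵥ (B *ᵥ v) ≤ (c₂ * (d : ℝ) ^ u + c₂) * (v ⬝ᵥ v)) ∧
      (∀ v ∈ S.mulVecLin.ker, v ⬝ᵥ (B *ᵥ v) ≤ c₂ * (v ⬝ᵥ v)) ∧
      ∀ v ∈ S.mulVecLin.range, c₁ * (d : ℝ) ^ ℓ * (v ⬝ᵥ v) ≤ v ⬝ᵥ (B *ᵥ v) := by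
  obtain ⟨S, Sig, rfl, hS, -, hrank, hspec, hlow, hhigh⟩ := hB
  rw [← Matrix.isHermitian_iff_isSymm] at hS
  have hSpos : S.PosSemidef := by
    refine Matrix.posSemidef_iff_isHermitian_and_spectrum_nonneg.2 ⟨hS, fun μ hμ => ?_⟩
    rw [Set.mem_ofPred_eq]
    rcases eq_or_ne μ 0 with rfl | h0
    · exact le_rfl
    · exact le_trans (by positivity) (hspec μ hμ h0).1
  have hS_nonneg (v : Fin k → ℝ) : 0 ≤ v ⬝ᵥ (S *ᵥ v) := hSpos.dotProduct_mulVec_nonneg v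
  have hS_le (v : Fin k → ℝ) : v ⬝ᵥ (S *ᵥ v) ≤ c₂ * (d : ℝ) ^ u * (v ⬝ᵥ v) :=
    dotProduct_mulVec_le_of_spectrum_le hS (fun μ hμ => by
      rcases eq_or_ne μ 0 with rfl | h0
      · positivity
      · exact (hspec μ hμ h0).2) v
  have hle_Sig (v : Fin k → ℝ) : c₁ * (v ⬝ᵥ v) ≤ v ⬝ᵥ (Sig *ᵥ v) := by
    simpa [Matrix.sub_mulVec, dotProduct_sub, Matrix.smul_mulVec] using
      hlow.dotProduct_mulVec_nonneg v
  have hSig_le (v : Fin k → ℝ) : v ⬝ᵥ (Sig *ᵥ v) ≤ c₂ * (v ⬝ᵥ v) := by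
    simpa [Matrix.sub_mulVec, dotProduct_sub, Matrix.smul_mulVec] using
      hhigh.dotProduct_mulVec_nonneg v
  have hself (v : Fin k → ℝ) : 0 ≤ v ⬝ᵥ v := dotProduct_star_self_nonneg v
  simp only [Matrix.add_mulVec, dotProduct_add]
  refine ⟨S, hrank, fun v => ?_, fun v => ?_, fun v hv => ?_, fun v hv => ?_⟩
  · linarith [hS_nonneg v, hle_Sig v]
  · linarith [hS_le v, hSig_le v]
  · rw [show S *ᵥ v = 0 from hv, dotProduct_zero, zero_add]
    exact hSig_le v
  · have := le_dotProduct_mulVec_of_mem_range hS (fun μ hμ h0 => (hspec μ hμ h0).1) hv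
    linarith [hle_Sig v, mul_nonneg hc₁ (hself v)]

theorem MultiSpiked.eigenvalue_bounds (hc₁ : 0 ≤ c₁) (hc₂ : 0 ≤ c₂)
    {U : Matrix.orthogonalGroup (Fin k) ℝ} {lam : Fin k → ℝ} (hlam : Antitone lam)
    (hB : MultiSpiked c₁ c₂ ℓ u d r (conjDiagonal U lam)) (j : Fin k) :
    c₁ ≤ lam j ∧ lam j ≤ c₂ * (d : ℝ) ^ u + c₂ ∧ (r ≤ (j : ℕ) → lam j ≤ c₂) ∧
      ((j : ℕ) < r → c₁ * (d : ℝ) ^ ℓ ≤ lam j) := by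
  obtain ⟨S, hrank, hlow, hhigh, hker, hrange⟩ :=
    hB.exists_rank_eq_forall_dotProduct_bounds hc₁ hc₂
  have hdim := S.mulVecLin.finrank_range_add_finrank_ker
  rw [← Matrix.rank, hrank, Module.finrank_fin_fun] at hdim
  refine ⟨le_eigenvalue_of_forall_mem hlam ⊤ (by simp) fun v _ => hlow v,
    eigenvalue_le_of_forall_mem hlam ⊤ (by simp) fun v _ => hhigh v,
    fun hj => eigenvalue_le_of_forall_mem hlam _ (by omega) hker,
    fun hj => le_eigenvalue_of_forall_mem hlam _ ?_ hrange⟩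
  rwa [← Matrix.rank, hrank]

theorem IsOrderedEigenbasis.exists_eq_conjDiagonal {B U : Matrix (Fin k) (Fin k) ℝ}
    (hU : IsOrderedEigenbasis B U) :
    ∃ (V : Matrix.orthogonalGroup (Fin k) ℝ) (lam : Fin k → ℝ),
      (V : Matrix (Fin k) (Fin k) ℝ) = U ∧ Antitone lam ∧ B = conjDiagonal V lam :=
  ⟨⟨U, hU.1⟩, hU.2.choose, rfl, hU.2.choose_spec⟩

theorem exists_isOrderedEigenbasis {B : Matrix (Fin k) (Fin k) ℝ} (hB : B.IsHermitian) :
    ∃ U, IsOrderedEigenbasis B U := by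
  set V := hB.eigenvectorUnitary
  let σ : Equiv.Perm (Fin k) := Tuple.sort fun i => - hB.eigenvalues i
  refine ⟨(V : Matrix (Fin k) (Fin k) ℝ).submatrix id σ, ?_, hB.eigenvalues ∘ σ, fun i j hij => ?_,
    ?_⟩
  · rw [Matrix.mem_orthogonalGroup_iff', Matrix.transpose_submatrix,
      ← Matrix.submatrix_mul _ _ _ id _ Function.bijective_id, transpose_mul_orthogonal,
      Matrix.submatrix_one_equiv]
  · simpa using Tuple.monotone_sort (fun i => - hB.eigenvalues i) hij
  · rw [← Matrix.submatrix_diagonal_equiv, Matrix.transpose_submatrix, Matrix.submatrix_mul_equiv,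
      Matrix.submatrix_mul_equiv, Matrix.submatrix_id_id, ← conjDiagonal_apply]
    exact eq_conjDiagonal hB

end Spectrum

section Filter

variable {η x : ℝ} {t : ℕ}

theorem exp_neg_two_mul_le_one_sub (hx0 : 0 ≤ x) (hx : x ≤ 1 / 2) :
    Real.exp (-(2 * x)) ≤ 1 - x := by
  have hinv : (1 - x)⁻¹ ≤ 1 + 2 * x := by
    rw [inv_le_iff_one_le_mul₀ (by linarith)]
    nlinarith
  rw [← Real.le_log_iff_exp_le (by linarith)]
  linarith [Real.one_sub_inv_le_log_of_pos (show 0 < 1 - x by linarith)]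

theorem gdFilter_nonneg (hx : 0 ≤ x) (hηx : η * x ≤ 1) : 0 ≤ gdFilter η t x :=
  mul_nonneg (pow_nonneg (sub_nonneg.2 hηx) t) hx

theorem exp_mul_le_gdFilter (hx : 0 ≤ x) (hηx0 : 0 ≤ η * x) (hηx : η * x ≤ 1 / 2) :
    Real.exp (-(2 * (η * x * t))) * x ≤ gdFilter η t x := by
  refine mul_le_mul_of_nonneg_right ?_ hx
  rw [show -(2 * (η * x * t)) = t * -(2 * (η * x)) by ring, Real.exp_nat_mul]
  exact pow_le_pow_left₀ (Real.exp_pos _).le (exp_neg_two_mul_le_one_sub hηx0 hηx) t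

theorem gdFilter_le_exp_mul (hx : 0 ≤ x) (hηx : η * x ≤ 1) :
    gdFilter η t x ≤ Real.exp (-(η * x * t)) * x := by
  refine mul_le_mul_of_nonneg_right ?_ hx
  rw [show -(η * x * t) = t * -(η * x) by ring, Real.exp_nat_mul]
  exact pow_le_pow_left₀ (sub_nonneg.2 hηx) (Real.one_sub_le_exp_neg _) t

theorem gdFilter_le_self (hx : 0 ≤ x) (hηx0 : 0 ≤ η * x) (hηx : η * x ≤ 1) :
    gdFilter η t x ≤ x :=
  mul_le_of_le_one_left hx (pow_le_one₀ (by linarith) (by linarith))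

variable {c₁ c₂ c ℓ u C₂ L : ℝ} {d : ℕ}

theorem mul_exp_le_gdFilter_of_bulk (hc₁ : 0 < c₁) (hc : 0 < c) (hd : 0 < d)
    (hd' : c₂ / (c * c₁) / (d : ℝ) ^ u ≤ 1 / 2) (ht : (t : ℝ) ≤ C₂ * (d : ℝ) ^ u)
    (hL : c₁ * (d : ℝ) ^ u ≤ L) (hx : c₁ ≤ x) (hx' : x ≤ c₂) :
    c₁ * Real.exp (-(2 * (c₂ / (c * c₁) * C₂))) ≤ gdFilter (1 / (c * L)) t x := by
  have hdu : (0 : ℝ) < (d : ℝ) ^ u := by positivity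
  have hx0 : 0 < x := hc₁.trans_le hx
  have hc₂ : 0 < c₂ := hx0.trans_le hx'
  have hL0 : 0 < L := (mul_pos hc₁ hdu).trans_le hL
  have hηx : 1 / (c * L) * x ≤ c₂ / (c * c₁) / (d : ℝ) ^ u := by
    rw [one_div_mul_eq_div, div_div, mul_assoc]
    gcongr
  have hηxt : 1 / (c * L) * x * t ≤ c₂ / (c * c₁) * C₂ := by
    calc 1 / (c * L) * x * t ≤ c₂ / (c * c₁) / (d : ℝ) ^ u * (C₂ * (d : ℝ) ^ u) := by gcongr
      _ = c₂ / (c * c₁) * C₂ := by field_simp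
  refine le_trans ?_ (exp_mul_le_gdFilter hx0.le (by positivity) (hηx.trans hd'))
  rw [mul_comm]
  gcongr

theorem gdFilter_le_of_spike (hc₁ : 0 < c₁) (hc₂ : 0 < c₂) (hc : 1 ≤ c) (hu : 0 ≤ u) (hd : 0 < d)
    (ht : 2 * c * c₂ * u / c₁ * (d : ℝ) ^ (u - ℓ) * Real.log d ≤ t) (hL0 : 0 < L)
    (hL : L ≤ 2 * c₂ * (d : ℝ) ^ u) (hxL : x ≤ L) (hx : c₁ * (d : ℝ) ^ ℓ ≤ x) :
    gdFilter (1 / (c * L)) t x ≤ 2 * c₂ := by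
  have hd0 : (0 : ℝ) < d := by exact_mod_cast hd
  have : 0 ≤ Real.log d := Real.log_natCast_nonneg d
  have hx0 : 0 < x := lt_of_lt_of_le (by positivity) hx
  have hηx : 1 / (c * L) * x ≤ 1 := by
    rw [one_div_mul_eq_div, div_le_one (by positivity)]
    nlinarith
  have hηxt : u * Real.log d ≤ 1 / (c * L) * x * t := by
    calc u * Real.log d = c₁ * (d : ℝ) ^ ℓ / (c * (2 * c₂ * (d : ℝ) ^ u)) *
          (2 * c * c₂ * u / c₁ * (d : ℝ) ^ (u - ℓ) * Real.log d) := by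
          rw [Real.rpow_sub hd0]
          field_simp
      _ ≤ 1 / (c * L) * x * t := by
          rw [one_div_mul_eq_div]
          gcongr
  calc gdFilter (1 / (c * L)) t x ≤ Real.exp (-(1 / (c * L) * x * t)) * x :=
        gdFilter_le_exp_mul hx0.le hηx
    _ ≤ Real.exp (-(u * Real.log d)) * (2 * c₂ * (d : ℝ) ^ u) := by
        gcongr
        exact hxL.trans hL
    _ = 2 * c₂ := by
        rw [Real.exp_neg, mul_comm u, ← Real.rpow_def_of_pos hd0]
        field_simp

theorem gram_isHermitian {k n : ℕ} (A : Matrix (Fin k) (Fin n) ℝ) : (gram A).IsHermitian := by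
  simp [gram, Matrix.IsSymm, Matrix.transpose_smul, Matrix.transpose_mul]

theorem opNorm_eq_norm {m k : ℕ} (M : Matrix (Fin m) (Fin k) ℝ) : opNorm M = ‖M‖ := rfl

theorem exists_gradAt_eq_mul_conjDiagonal (hc₁ : 0 < c₁) (hc₂ : 0 < c₂) (hc : 1 ≤ c) (hu : 0 ≤ u)
    (hd : 0 < d) (hd' : c₂ / (c * c₁) / (d : ℝ) ^ u ≤ 1 / 2) {k n r : ℕ}
    {A : Matrix (Fin k) (Fin n) ℝ} (hA : MultiSpiked c₁ c₂ ℓ u d r (gram A))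
    (hop : c₁ * (d : ℝ) ^ u ≤ opNorm (gram A)) {U : Matrix.orthogonalGroup (Fin k) ℝ}
    {lam : Fin k → ℝ} (hlam : Antitone lam) (hU : gram A = conjDiagonal U lam)
    (ht : InWindow (2 * c * c₂ * u / c₁) C₂ ℓ u d t) :
    ∃ f : Fin k → ℝ, (∀ j, |f j| ≤ 2 * c₂) ∧
      (∀ j : Fin k, r ≤ (j : ℕ) → c₁ * Real.exp (-(2 * (c₂ / (c * c₁) * C₂))) ≤ |f j|) ∧
      ∀ (m : ℕ) (W : Matrix (Fin m) (Fin k) ℝ), gradAt c A W t = W * conjDiagonal U f := by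
  have hd1 : (1 : ℝ) ≤ d := by exact_mod_cast hd
  have hdu : (1 : ℝ) ≤ (d : ℝ) ^ u := Real.one_le_rpow hd1 hu
  have hbounds := (hU ▸ hA).eigenvalue_bounds hc₁.le hc₂.le hlam
  have hpos (j : Fin k) : 0 < lam j := hc₁.trans_le (hbounds j).1
  have hL0 : 0 < opNorm (gram A) := lt_of_lt_of_le (by positivity) hop
  have hnorm : opNorm (gram A) = ‖lam‖ := by rw [opNorm_eq_norm, hU, norm_conjDiagonal]
  have hle (j : Fin k) : lam j ≤ opNorm (gram A) :=
    hnorm ▸ (le_abs_self _).trans (norm_le_pi_norm lam j)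
  have hL : opNorm (gram A) ≤ 2 * c₂ * (d : ℝ) ^ u := by
    rw [hnorm, pi_norm_le_iff_of_nonneg (by positivity)]
    intro j
    rw [Real.norm_of_nonneg (hpos j).le]
    nlinarith [(hbounds j).2.1]
  have hη (j : Fin k) : 1 / (c * opNorm (gram A)) * lam j ≤ 1 := by
    rw [one_div_mul_eq_div, div_le_one (by positivity)]
    nlinarith [hle j]
  refine ⟨_, fun j => ?_, fun j hj => ?_, fun m W => gradAt_eq_mul_conjDiagonal c W t hU⟩
  all_goals rw [abs_neg, abs_of_nonneg (gdFilter_nonneg (hpos j).le (hη j))]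
  · rcases le_or_gt r j with hj | hj
    · exact (gdFilter_le_self (hpos j).le (mul_nonneg (by positivity) (hpos j).le) (hη j)).trans
        (((hbounds j).2.2.1 hj).trans (by linarith))
    · exact gdFilter_le_of_spike hc₁ hc₂ hc hu hd ht.1 hL0 hL (hle j) ((hbounds j).2.2.2 hj)
  · exact mul_exp_le_gdFilter_of_bulk hc₁ (by linarith) hd hd' ht.2 hop (hbounds j).1
      ((hbounds j).2.2.1 hj)

end Filter

section Columns

variable {m k : ℕ} {r : ℕ}

/-- The first `r` columns of `M`, complementing `lastCols r M`. -/
def firstCols (r : ℕ) (M : Matrix (Fin m) (Fin k) ℝ) :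
    Matrix (Fin m) {j : Fin k // ¬ r ≤ (j : ℕ)} ℝ :=
  M.submatrix id Subtype.val

theorem lastCols_mul {n : ℕ} (r : ℕ) (M : Matrix (Fin m) (Fin n) ℝ)
    (N : Matrix (Fin n) (Fin k) ℝ) : lastCols r (M * N) = M * lastCols r N :=
  rfl

theorem frobNorm_lastCols_sq_add_firstCols_sq (r : ℕ) (M : Matrix (Fin m) (Fin k) ℝ) :
    frobNorm (lastCols r M) ^ 2 + frobNorm (firstCols r M) ^ 2 = frobNorm M ^ 2 := by
  simp only [frobNorm_sq, lastCols, firstCols, Matrix.submatrix_apply, id_eq]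
  rw [← Finset.sum_add_distrib]
  exact Finset.sum_congr rfl fun i _ =>
    Fintype.sum_subtype_add_sum_subtype (fun j : Fin k => r ≤ (j : ℕ)) fun j => M i j ^ 2

theorem card_not_le_coe_le (k r : ℕ) : Fintype.card {j : Fin k // ¬ r ≤ (j : ℕ)} ≤ r := by
  let toFin (j : {j : Fin k // ¬ r ≤ (j : ℕ)}) : Fin r := ⟨j, not_le.1 j.2⟩
  have hinj : Function.Injective toFin := fun i j h => Subtype.ext (Fin.ext (Fin.mk.inj h))
  simpa using Fintype.card_le_of_injective toFin hinj

theorem frobNorm_firstCols_mul_orthogonal_sq_le (r : ℕ) (M : Matrix (Fin m) (Fin k) ℝ)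
    (U : Matrix.orthogonalGroup (Fin k) ℝ) :
    frobNorm (firstCols r (M * (U : Matrix (Fin k) (Fin k) ℝ))) ^ 2 ≤ r * ‖M‖ ^ 2 := by
  rw [frobNorm_sq, Finset.sum_comm]
  calc ∑ j : {j : Fin k // ¬ r ≤ (j : ℕ)}, ∑ i, (M * (U : Matrix (Fin k) (Fin k) ℝ)) i j ^ 2
      ≤ ∑ _j : {j : Fin k // ¬ r ≤ (j : ℕ)}, ‖M‖ ^ 2 :=
        Finset.sum_le_sum fun j _ => sum_mul_orthogonal_sq_le M U j
    _ = Fintype.card {j : Fin k // ¬ r ≤ (j : ℕ)} * ‖M‖ ^ 2 := by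
        rw [Finset.sum_const, Finset.card_univ, nsmul_eq_mul]
    _ ≤ r * ‖M‖ ^ 2 := by
        gcongr
        exact card_not_le_coe_le k r

variable {U : Matrix.orthogonalGroup (Fin k) ℝ} {f : Fin k → ℝ} {a C : ℝ}

theorem exists_lastCols_mul_orthogonal_eq (ha : 0 < a)
    (hf : ∀ j : Fin k, r ≤ (j : ℕ) → a ≤ |f j|) :
    ∃ F : Matrix (Fin k) {j : Fin k // r ≤ (j : ℕ)} ℝ, ‖F‖ ≤ a⁻¹ ∧
      ∀ (m : ℕ) (W : Matrix (Fin m) (Fin k) ℝ),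
        lastCols r (W * (U : Matrix (Fin k) (Fin k) ℝ)) = W * conjDiagonal U f * F := by
  refine ⟨lastCols r ((U : Matrix (Fin k) (Fin k) ℝ) * Matrix.diagonal f⁻¹), ?_, fun m W => ?_⟩
  · have hgram : (lastCols r ((U : Matrix (Fin k) (Fin k) ℝ) * Matrix.diagonal f⁻¹))ᵀ *
        lastCols r ((U : Matrix (Fin k) (Fin k) ℝ) * Matrix.diagonal f⁻¹) =
        Matrix.diagonal fun j : {j : Fin k // r ≤ (j : ℕ)} => (f j)⁻¹ * (f j)⁻¹ := by
      rw [lastCols, Matrix.transpose_submatrix, ← Matrix.submatrix_mul _ _ _ id _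
        Function.bijective_id, Matrix.transpose_mul, Matrix.mul_assoc,
        ← Matrix.mul_assoc (U : Matrix (Fin k) (Fin k) ℝ)ᵀ, transpose_mul_orthogonal,
        Matrix.one_mul, Matrix.diagonal_transpose, Matrix.diagonal_mul_diagonal,
        Matrix.submatrix_diagonal _ _ Subtype.val_injective]
      rfl
    refine le_of_sq_le_sq ?_ (by positivity)
    rw [sq, ← Matrix.l2_opNorm_conjTranspose_mul_self, Matrix.conjTranspose_eq_transpose_of_trivial,
      hgram, Matrix.l2_opNorm_diagonal, pi_norm_le_iff_of_nonneg (by positivity)]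
    intro j
    rw [norm_mul, norm_inv, Real.norm_eq_abs, ← sq]
    gcongr
    exact hf j j.2
  · rw [← lastCols_mul, ← Matrix.mul_assoc, Matrix.mul_assoc W, conjDiagonal_mul_orthogonal]
    ext i j
    have hj : f j ≠ 0 := abs_pos.1 (ha.trans_le (hf j j.2))
    simp [lastCols, ← Matrix.mul_assoc, Matrix.mul_diagonal, hj]

theorem mul_nucNorm_lastCols_le (ha : 0 < a) (hf : ∀ j : Fin k, r ≤ (j : ℕ) → a ≤ |f j|)
    (W : Matrix (Fin m) (Fin k) ℝ) :
    a * nucNorm (lastCols r (W * (U : Matrix (Fin k) (Fin k) ℝ))) ≤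
      nucNorm (W * conjDiagonal U f) := by
  obtain ⟨F, hF, hlast⟩ := exists_lastCols_mul_orthogonal_eq (U := U) ha hf
  have hnonneg := nucNorm_nonneg (W * conjDiagonal U f)
  rw [hlast, ← le_inv_mul_iff₀ ha, mul_comm a⁻¹]
  exact (nucNorm_mul_le _ F).trans (by gcongr)

theorem mul_frobNorm_lastCols_le (ha : 0 < a) (hf : ∀ j : Fin k, r ≤ (j : ℕ) → a ≤ |f j|)
    (W : Matrix (Fin m) (Fin k) ℝ) :
    a * frobNorm (lastCols r (W * (U : Matrix (Fin k) (Fin k) ℝ))) ≤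
      frobNorm (W * conjDiagonal U f) := by
  obtain ⟨F, hF, hlast⟩ := exists_lastCols_mul_orthogonal_eq (U := U) ha hf
  have hnonneg := frobNorm_nonneg (W * conjDiagonal U f)
  rw [hlast, ← le_inv_mul_iff₀ ha, mul_comm a⁻¹]
  exact (frobNorm_mul_le_mul_norm _ F).trans (by gcongr)

theorem norm_conjDiagonal_le (hC : 0 ≤ C) (hf : ∀ j, |f j| ≤ C) : ‖conjDiagonal U f‖ ≤ C := by
  rw [norm_conjDiagonal]
  exact (pi_norm_le_iff_of_nonneg hC).2 hf

theorem frobNorm_mul_conjDiagonal_le (hC : 0 ≤ C) (hf : ∀ j, |f j| ≤ C)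
    (W : Matrix (Fin m) (Fin k) ℝ) :
    frobNorm (W * conjDiagonal U f) ≤
      C * (frobNorm (lastCols r (W * (U : Matrix (Fin k) (Fin k) ℝ))) + √r * ‖W‖) := by
  have hW : frobNorm W ≤
      frobNorm (lastCols r (W * (U : Matrix (Fin k) (Fin k) ℝ))) + √r * ‖W‖ := by
    refine le_of_sq_le_sq ?_ (add_nonneg (frobNorm_nonneg _) (by positivity))
    have hfirst := frobNorm_firstCols_mul_orthogonal_sq_le r W U
    rw [← frobNorm_mul_orthogonal W U, ← frobNorm_lastCols_sq_add_firstCols_sq r, add_sq, mul_pow,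
      Real.sq_sqrt r.cast_nonneg]
    have := mul_nonneg (frobNorm_nonneg (lastCols r (W * (U : Matrix (Fin k) (Fin k) ℝ))))
      (mul_nonneg (Real.sqrt_nonneg r) (norm_nonneg W))
    linarith
  calc frobNorm (W * conjDiagonal U f) ≤ frobNorm W * ‖conjDiagonal U f‖ :=
        frobNorm_mul_le_mul_norm _ _
    _ ≤ _ * C := mul_le_mul hW (norm_conjDiagonal_le hC hf) (norm_nonneg _)
        ((frobNorm_nonneg W).trans hW)
    _ = _ := mul_comm _ _

theorem div_le_nuclearRank_mul_conjDiagonal (ha : 0 < a) (hC : 0 ≤ C) (hf : ∀ j, |f j| ≤ C)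
    (hf' : ∀ j : Fin k, r ≤ (j : ℕ) → a ≤ |f j|) (W : Matrix (Fin m) (Fin k) ℝ) {x y : ℝ}
    (hx : 0 < x) (hlast : x ≤ frobNorm (lastCols r (W * (U : Matrix (Fin k) (Fin k) ℝ))) ^ 2)
    (hgram : frobNorm (W * Wᵀ) ^ 2 ≤ y) :
    (a ^ 2 * x) ^ 2 / (C ^ 4 * y) ≤ nuclearRank (W * conjDiagonal U f) := by
  refine div_le_nuclearRank (by positivity) ?_ ?_
  · calc a ^ 2 * x ≤ (a * frobNorm (lastCols r (W * (U : Matrix (Fin k) (Fin k) ℝ)))) ^ 2 := by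
          rw [mul_pow]
          gcongr
      _ ≤ frobNorm (W * conjDiagonal U f) ^ 2 :=
          pow_le_pow_left₀ (mul_nonneg ha.le (frobNorm_nonneg _))
            (mul_frobNorm_lastCols_le ha hf' W) 2
  · calc frobNorm ((W * conjDiagonal U f)ᵀ * (W * conjDiagonal U f)) ^ 2
        ≤ (‖conjDiagonal U f‖ ^ 2 * frobNorm (W * Wᵀ)) ^ 2 :=
          pow_le_pow_left₀ (frobNorm_nonneg _) (frobNorm_transpose_mul_self_mul_le _ _) 2
      _ = ‖conjDiagonal U f‖ ^ 4 * frobNorm (W * Wᵀ) ^ 2 := by ring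
      _ ≤ C ^ 4 * y := by
          gcongr
          exact norm_conjDiagonal_le hC hf

theorem frobNorm_firstCols_orthogonal_sq_le (r : ℕ) (U : Matrix.orthogonalGroup (Fin k) ℝ) :
    frobNorm (firstCols r (U : Matrix (Fin k) (Fin k) ℝ)) ^ 2 ≤ r := by
  have hone : ‖(1 : Matrix (Fin k) (Fin k) ℝ)‖ ≤ 1 := by
    simpa only [map_one] using norm_conjDiagonal_le (U := U) (f := 1) zero_le_one (by simp)
  have hfirst := frobNorm_firstCols_mul_orthogonal_sq_le r (1 : Matrix (Fin k) (Fin k) ℝ) U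
  rw [Matrix.one_mul] at hfirst
  exact hfirst.trans (mul_le_of_le_one_right r.cast_nonneg (pow_le_one₀ (norm_nonneg _) hone))

end Columns

section Moments

variable {Ω : Type*} [MeasurableSpace Ω] {P : Measure Ω} {X Y : Ω → ℝ}

theorem integrable_pow_of_memLp [IsFiniteMeasure P] {a n : ℕ} (hX : MemLp X n P) (han : a ≤ n) :
    Integrable (fun ω => X ω ^ a) P := by
  refine (integrable_norm_iff (hX.1.pow a)).1 ?_
  simpa only [Pi.pow_apply, norm_pow] using
    integrable_norm_pow_of_le hX.1 han hX.integrable_norm_pow'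

theorem memLp_two_sq_of_memLp_four [IsFiniteMeasure P] (hX : MemLp X 4 P) :
    MemLp (fun ω => X ω ^ 2) 2 P := by
  refine (memLp_two_iff_integrable_sq (hX.1.pow 2)).2 ?_
  simpa only [Pi.pow_apply, ← pow_mul] using integrable_pow_of_memLp (n := 4) hX le_rfl

theorem memLp_mul_of_indepFun (h : IndepFun X Y P) {p : ENNReal} (hp : p ≠ 0) (hp' : p ≠ ⊤)
    (hX : MemLp X p P) (hY : MemLp Y p P) : MemLp (fun ω => X ω * Y ω) p P := by
  refine (integrable_norm_rpow_iff (hX.1.mul hY.1) hp hp').1 ?_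
  have hmeas : Measurable fun x : ℝ => ‖x‖ ^ p.toReal := by fun_prop
  have hprod := (h.comp hmeas hmeas).integrable_mul
    (hX.integrable_norm_rpow hp hp') (hY.integrable_norm_rpow hp hp')
  refine hprod.congr (Eventually.of_forall fun ω => ?_)
  simp [Real.mul_rpow]

theorem integral_pow_mul_pow_of_indepFun (h : IndepFun X Y P) (hX : AEStronglyMeasurable X P)
    (hY : AEStronglyMeasurable Y P) (a b : ℕ) :
    ∫ ω, X ω ^ a * Y ω ^ b ∂P = (∫ ω, X ω ^ a ∂P) * ∫ ω, Y ω ^ b ∂P :=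
  (h.comp (measurable_id.pow_const a) (measurable_id.pow_const b)).integral_fun_mul_eq_mul_integral
    (hX.pow a) (hY.pow b)

theorem covariance_le_of_variance_le [IsFiniteMeasure P] {β : ℝ} (hX : MemLp X 2 P)
    (hY : MemLp Y 2 P) (hXβ : variance X P ≤ β) (hYβ : variance Y P ≤ β) :
    covariance X Y P ≤ β := by
  have h := variance_sub hX hY ▸ variance_nonneg (X - Y) P
  linarith

theorem measureReal_ge_le_integral_div {E δ : ℝ} (hX : Integrable X P) (hX0 : ∀ ω, 0 ≤ X ω)
    (hE : ∫ ω, X ω ∂P ≤ E) (hδ : 0 < δ) : P.real {ω | δ ≤ X ω} ≤ E / δ := by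
  rw [le_div_iff₀ hδ, mul_comm]
  exact (mul_meas_ge_le_integral_of_nonneg (Eventually.of_forall hX0) hX δ).trans hE

theorem measureReal_add_le_variance_div_sq [IsFiniteMeasure P] {E V δ : ℝ} (hX : MemLp X 2 P)
    (hE : ∫ ω, X ω ∂P ≤ E) (hV : variance X P ≤ V) (hδ : 0 < δ) :
    P.real {ω | E + δ ≤ X ω} ≤ V / δ ^ 2 := by
  have hsub : {ω | E + δ ≤ X ω} ⊆ {ω | δ ≤ |X ω - ∫ x, X x ∂P|} := fun ω (hω : E + δ ≤ X ω) =>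
    le_abs.2 (Or.inl (le_sub_iff_add_le'.2 ((add_le_add_left hE δ).trans hω)))
  have hcheb := ENNReal.toReal_le_of_le_ofReal (div_nonneg (variance_nonneg X P) (sq_nonneg δ))
    (meas_ge_le_variance_div_sq hX hδ)
  calc P.real {ω | E + δ ≤ X ω} ≤ P.real {ω | δ ≤ |X ω - ∫ x, X x ∂P|} := measureReal_mono hsub
    _ ≤ variance X P / δ ^ 2 := hcheb
    _ ≤ V / δ ^ 2 := by gcongr

variable {ι : Type*}

theorem indepFun_of_dependsOn {X : ι → Ω → ℝ} (hX : iIndepFun X P)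
    (hmeas : ∀ i, AEMeasurable (X i) P) {S T : Finset ι} (hST : Disjoint S T)
    {f g : (ι → ℝ) → ℝ} (hf : Measurable f) (hg : Measurable g) (hfS : DependsOn f S)
    (hgT : DependsOn g T) :
    IndepFun (fun ω => f fun i => X i ω) (fun ω => g fun i => X i ω) P := by
  classical
  let extend (R : Finset ι) (x : R → ℝ) (i : ι) : ℝ := if hi : i ∈ R then x ⟨i, hi⟩ else 0
  have hextend (R : Finset ι) : Measurable (extend R) := measurable_pi_lambda _ fun i => by
    by_cases hi : i ∈ R
    · simpa [extend, hi] using measurable_pi_apply _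
    · simp [extend, hi]
  have hrestrict := (hX.indepFun_finset₀ S T hST hmeas).comp (hf.comp (hextend S))
    (hg.comp (hextend T))
  convert hrestrict using 1
  · exact funext fun ω => hfS fun i hi => by simp [extend, Finset.mem_coe.1 hi]
  · exact funext fun ω => hgT fun i hi => by simp [extend, Finset.mem_coe.1 hi]

variable [IsProbabilityMeasure P]

theorem integral_add_pow_four_of_indepFun (h : IndepFun X Y P) (hX : MemLp X 4 P)
    (hY : MemLp Y 4 P) (hX0 : ∫ ω, X ω ∂P = 0) (hY0 : ∫ ω, Y ω ∂P = 0) :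
    ∫ ω, (X ω + Y ω) ^ 4 ∂P = ∫ ω, X ω ^ 4 ∂P +
      6 * ((∫ ω, X ω ^ 2 ∂P) * ∫ ω, Y ω ^ 2 ∂P) + ∫ ω, Y ω ^ 4 ∂P := by
  have hbinom (ω : Ω) : (X ω + Y ω) ^ 4 =
      ∑ a ∈ Finset.range 5, X ω ^ a * Y ω ^ (4 - a) * (Nat.choose 4 a : ℝ) := add_pow _ _ 4
  have hint : ∀ a ∈ Finset.range 5,
      Integrable (fun ω => X ω ^ a * Y ω ^ (4 - a) * (Nat.choose 4 a : ℝ)) P := fun a ha =>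
    ((h.comp (measurable_id.pow_const a) (measurable_id.pow_const (4 - a))).integrable_mul
      (integrable_pow_of_memLp (n := 4) hX (by simp at ha; omega))
      (integrable_pow_of_memLp (n := 4) hY (by omega))).mul_const _
  simp only [hbinom]
  rw [integral_finsetSum _ hint]
  simp only [integral_mul_const, integral_pow_mul_pow_of_indepFun h hX.1 hY.1]
  norm_num [Finset.sum_range_succ, hX0, hY0, Nat.choose]
  ring

theorem integral_sum_sq_of_pairwise_indepFun {X : ι → Ω → ℝ} (s : Finset ι)
    (hX : ∀ i, MemLp (X i) 2 P) (h0 : ∀ i, ∫ ω, X i ω ∂P = 0)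
    (hind : Pairwise fun i j => IndepFun (X i) (X j) P) :
    ∫ ω, (∑ i ∈ s, X i ω) ^ 2 ∂P = ∑ i ∈ s, ∫ ω, X i ω ^ 2 ∂P := by
  have hvar := IndepFun.variance_sum (s := s) (fun i _ => hX i) fun i _ j _ hij => hind hij
  have hsum0 : ∫ ω, (∑ i ∈ s, X i) ω ∂P = 0 := by
    simp only [Finset.sum_apply]
    rw [integral_finsetSum s fun i _ => (hX i).integrable one_le_two]
    simp only [h0, Finset.sum_const_zero]
  rw [variance_of_integral_eq_zero (memLp_finsetSum' s fun i _ => hX i).1.aemeasurable hsum0]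
    at hvar
  simp only [Finset.sum_apply] at hvar
  rw [hvar]
  exact Finset.sum_congr rfl fun i _ => variance_of_integral_eq_zero (hX i).1.aemeasurable (h0 i)

theorem integral_sum_pow_four_le {X : ι → Ω → ℝ} (s : Finset ι) (hX : ∀ i, MemLp (X i) 4 P)
    (h0 : ∀ i, ∫ ω, X i ω ∂P = 0)
    (hind : ∀ (s : Finset ι), ∀ i ∉ s, IndepFun (X i) (fun ω => ∑ j ∈ s, X j ω) P) :
    ∫ ω, (∑ i ∈ s, X i ω) ^ 4 ∂P ≤
      ∑ i ∈ s, ∫ ω, X i ω ^ 4 ∂P + 3 * (∑ i ∈ s, ∫ ω, X i ω ^ 2 ∂P) ^ 2 := by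
  classical
  have hpair : Pairwise fun i j => IndepFun (X i) (X j) P := fun i j hij => by
    simpa using hind {j} i (by simpa using hij)
  have hX2 (i : ι) : MemLp (X i) 2 P := (hX i).mono_exponent (by norm_num)
  induction s using Finset.induction_on with
  | empty => simp
  | insert i s hi ih =>
    have hsum0 : ∫ ω, ∑ j ∈ s, X j ω ∂P = 0 := by
      rw [integral_finsetSum s fun j _ => (hX2 j).integrable one_le_two]
      simp only [h0, Finset.sum_const_zero]
    simp only [Finset.sum_insert hi]
    rw [integral_add_pow_four_of_indepFun (hind s i hi) (hX i) (memLp_finsetSum s fun j _ => hX j)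
      (h0 i) hsum0, integral_sum_sq_of_pairwise_indepFun s hX2 h0 hpair]
    nlinarith [sq_nonneg (∫ ω, X i ω ^ 2 ∂P)]

theorem variance_sum_le_of_covariance_le {Y : ι → Ω → ℝ} {s : Finset ι} {β : ℝ} {n : ℕ}
    (hY : ∀ i ∈ s, MemLp (Y i) 2 P) (hβ : ∀ i ∈ s, variance (Y i) P ≤ β) (N : ι → Finset ι)
    (hN : ∀ i ∈ s, (N i).card ≤ n)
    (hcov : ∀ i ∈ s, ∀ j ∈ s, j ∉ N i → covariance (Y i) (Y j) P = 0) :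
    variance (∑ i ∈ s, Y i) P ≤ s.card * (n * β) := by
  classical
  rw [variance_sum' hY, ← nsmul_eq_mul]
  refine Finset.sum_le_card_nsmul s _ _ fun i hi => ?_
  have hβ0 : 0 ≤ β := (variance_nonneg (Y i) P).trans (hβ i hi)
  calc ∑ j ∈ s, covariance (Y i) (Y j) P
      = ∑ j ∈ s with j ∈ N i, covariance (Y i) (Y j) P :=
        (Finset.sum_filter_of_ne fun j hj hne => by_contra fun h => hne (hcov i hi j hj h)).symm
    _ ≤ (s.filter (· ∈ N i)).card • β := Finset.sum_le_card_nsmul _ _ _ fun j hj =>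
        have hjs := (Finset.mem_filter.1 hj).1
        covariance_le_of_variance_le (hY i hi) (hY j hjs) (hβ i hi) (hβ j hjs)
    _ ≤ n * β := by
        rw [nsmul_eq_mul]
        gcongr
        exact (Finset.card_le_card fun j hj => (Finset.mem_filter.1 hj).2).trans (hN i hi)

end Moments

theorem card_offDiag_univ_le (p : Type*) [Fintype p] :
    (Finset.univ : Finset p).offDiag.card ≤ Fintype.card p ^ 2 := by
  rw [Finset.offDiag_card, Finset.card_univ, sq]
  exact Nat.sub_le _ _

section IndepEntries

variable {Ω p q : Type*} [MeasurableSpace Ω] {P : Measure Ω}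

/-- The random matrix `W` has independent centered entries of variance `v`, whose fourth moments
are at most `Γ v²`. The entries need not be identically distributed. -/
structure HasIndepEntries (P : Measure Ω) (v Γ : ℝ) (W : Ω → Matrix p q ℝ) : Prop where
  memLp : ∀ i j, MemLp (fun ω => W ω i j) 4 P
  integral_eq_zero : ∀ i j, ∫ ω, W ω i j ∂P = 0
  integral_sq : ∀ i j, ∫ ω, W ω i j ^ 2 ∂P = v
  integral_pow_four_le : ∀ i j, ∫ ω, W ω i j ^ 4 ∂P ≤ Γ * v ^ 2
  iIndepFun : iIndepFun (fun (e : p × q) ω => W ω e.1 e.2) P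

namespace HasIndepEntries

variable {v Γ : ℝ} {W : Ω → Matrix p q ℝ}

section Entries

theorem indepFun_of_ne_left (hW : HasIndepEntries P v Γ W) {i i' : p} (hi : i ≠ i') (j j' : q) :
    IndepFun (fun ω => W ω i j) (fun ω => W ω i' j') P :=
  hW.iIndepFun.indepFun (i := (i, j)) (j := (i', j')) (by simp [hi])

theorem indepFun_of_ne_right (hW : HasIndepEntries P v Γ W) (i i' : p) {j j' : q} (hj : j ≠ j') :
    IndepFun (fun ω => W ω i j) (fun ω => W ω i' j') P :=
  hW.iIndepFun.indepFun (i := (i, j)) (j := (i', j')) (by simp [hj])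

variable [IsProbabilityMeasure P]

theorem memLp_two (hW : HasIndepEntries P v Γ W) (i : p) (j : q) :
    MemLp (fun ω => W ω i j) 2 P :=
  (hW.memLp i j).mono_exponent (by norm_num)

theorem memLp_sq (hW : HasIndepEntries P v Γ W) (i : p) (j : q) :
    MemLp (fun ω => W ω i j ^ 2) 2 P :=
  memLp_two_sq_of_memLp_four (hW.memLp i j)

end Entries

section Diagonal

variable [Fintype q] [IsProbabilityMeasure P]

theorem memLp_mul_transpose_diag (hW : HasIndepEntries P v Γ W) (i : p) :
    MemLp (fun ω => (W ω * (W ω)ᵀ) i i) 2 P := by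
  simp only [mul_transpose_self_apply_self]
  exact memLp_finsetSum _ fun l _ => hW.memLp_sq i l

theorem integral_mul_transpose_diag (hW : HasIndepEntries P v Γ W) (i : p) :
    ∫ ω, (W ω * (W ω)ᵀ) i i ∂P = Fintype.card q * v := by
  simp only [mul_transpose_self_apply_self]
  rw [integral_finsetSum _ fun l _ => (hW.memLp_two i l).integrable_sq]
  simp [hW.integral_sq]

theorem variance_mul_transpose_diag_le (hW : HasIndepEntries P v Γ W) (i : p) :
    variance (fun ω => (W ω * (W ω)ᵀ) i i) P ≤ Fintype.card q * (Γ * v ^ 2) := by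
  have hind (l l' : q) (hl : l ≠ l') :
      IndepFun (fun ω => W ω i l ^ 2) (fun ω => W ω i l' ^ 2) P :=
    (hW.indepFun_of_ne_right i i hl).comp (measurable_id.pow_const 2) (measurable_id.pow_const 2)
  have hvar (l : q) : variance (fun ω => W ω i l ^ 2) P ≤ Γ * v ^ 2 := by
    refine (variance_le_expectation_sq (hW.memLp_sq i l).1).trans ?_
    simpa only [Pi.pow_apply, ← pow_mul] using hW.integral_pow_four_le i l
  calc variance (fun ω => (W ω * (W ω)ᵀ) i i) P
      = variance (∑ l, fun ω => W ω i l ^ 2) P := by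
        congr 1
        ext ω
        simp only [mul_transpose_self_apply_self, Finset.sum_apply]
    _ = ∑ l, variance (fun ω => W ω i l ^ 2) P :=
        IndepFun.variance_sum (fun l _ => hW.memLp_sq i l) fun l _ l' _ hl => hind l l' hl
    _ ≤ Fintype.card q * (Γ * v ^ 2) := by
        rw [← nsmul_eq_mul]
        exact Finset.sum_le_card_nsmul _ _ _ fun l _ => hvar l

theorem measureReal_sum_mul_transpose_diag_sub_sq_ge_le [Fintype p]
    (hW : HasIndepEntries P v Γ W) {δ : ℝ} (hδ : 0 < δ) :
    P.real {ω | δ ≤ ∑ i, ((W ω * (W ω)ᵀ) i i - Fintype.card q * v) ^ 2} ≤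
      Fintype.card p * (Fintype.card q * (Γ * v ^ 2)) / δ := by
  have hint (i : p) : Integrable (fun ω => ((W ω * (W ω)ᵀ) i i - Fintype.card q * v) ^ 2) P :=
    ((hW.memLp_mul_transpose_diag i).sub (memLp_const _)).integrable_sq
  refine measureReal_ge_le_integral_div (integrable_finsetSum _ fun i _ => hint i)
    (fun ω => Finset.sum_nonneg fun i _ => sq_nonneg _) ?_ hδ
  have hvar (i : p) : ∫ ω, ((W ω * (W ω)ᵀ) i i - Fintype.card q * v) ^ 2 ∂P ≤
      Fintype.card q * (Γ * v ^ 2) := by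
    rw [← hW.integral_mul_transpose_diag i,
      ← variance_eq_integral (hW.memLp_mul_transpose_diag i).1.aemeasurable]
    exact hW.variance_mul_transpose_diag_le i
  rw [integral_finsetSum _ fun i _ => hint i]
  exact (Finset.sum_le_card_nsmul _ _ _ fun i _ => hvar i).trans_eq (nsmul_eq_mul _ _)

end Diagonal

section Product

variable {n : Type*} [Fintype q] [IsProbabilityMeasure P]

theorem integrable_mul_apply_sq (hW : HasIndepEntries P v Γ W) (N : Matrix q n ℝ) (i : p) (j : n) :
    Integrable (fun ω => (W ω * N) i j ^ 2) P :=
  (memLp_finsetSum _ fun l _ => (hW.memLp_two i l).mul_const (N l j)).integrable_sq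

theorem integral_mul_apply_sq (hW : HasIndepEntries P v Γ W) (N : Matrix q n ℝ) (i : p) (j : n) :
    ∫ ω, (W ω * N) i j ^ 2 ∂P = v * ∑ l, N l j ^ 2 := by
  simp only [Matrix.mul_apply]
  rw [integral_sum_sq_of_pairwise_indepFun _ fun l => (hW.memLp_two i l).mul_const (N l j)]
  · simp only [mul_pow, integral_mul_const, hW.integral_sq, Finset.mul_sum]
  · simp only [integral_mul_const, hW.integral_eq_zero, zero_mul, implies_true]
  · exact fun l l' hl => (hW.indepFun_of_ne_right i i hl).comp
      (measurable_id.mul_const (N l j)) (measurable_id.mul_const (N l' j))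

variable [Fintype p] [Fintype n]

theorem integrable_frobNorm_mul_sq (hW : HasIndepEntries P v Γ W) (N : Matrix q n ℝ) :
    Integrable (fun ω => frobNorm (W ω * N) ^ 2) P := by
  simp only [frobNorm_sq]
  exact integrable_finsetSum _ fun i _ => integrable_finsetSum _ fun j _ =>
    hW.integrable_mul_apply_sq N i j

theorem integral_frobNorm_mul_sq (hW : HasIndepEntries P v Γ W) (N : Matrix q n ℝ) :
    ∫ ω, frobNorm (W ω * N) ^ 2 ∂P = Fintype.card p * (v * frobNorm N ^ 2) := by
  have hint := hW.integrable_mul_apply_sq N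
  simp only [frobNorm_sq]
  rw [integral_finsetSum _ fun i _ => integrable_finsetSum _ fun j _ => hint i j]
  simp only [integral_finsetSum _ fun j _ => hint _ j, hW.integral_mul_apply_sq]
  rw [Finset.sum_const, Finset.card_univ, nsmul_eq_mul, ← Finset.mul_sum, Finset.sum_comm]

end Product

section Rows

variable {i j : p}

theorem memLp_mul_of_ne (hW : HasIndepEntries P v Γ W) (hij : i ≠ j) (l : q) :
    MemLp (fun ω => W ω i l * W ω j l) 4 P :=
  memLp_mul_of_indepFun (hW.indepFun_of_ne_left hij l l) (by norm_num) (by norm_num)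
    (hW.memLp i l) (hW.memLp j l)

theorem integral_mul_of_ne (hW : HasIndepEntries P v Γ W) (hij : i ≠ j) (l : q) :
    ∫ ω, W ω i l * W ω j l ∂P = 0 := by
  rw [(hW.indepFun_of_ne_left hij l l).integral_fun_mul_eq_mul_integral (hW.memLp i l).1
    (hW.memLp j l).1, hW.integral_eq_zero, zero_mul]

theorem integral_mul_sq_of_ne (hW : HasIndepEntries P v Γ W) (hij : i ≠ j) (l : q) :
    ∫ ω, (W ω i l * W ω j l) ^ 2 ∂P = v ^ 2 := by
  simp only [mul_pow]
  rw [integral_pow_mul_pow_of_indepFun (hW.indepFun_of_ne_left hij l l) (hW.memLp i l).1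
    (hW.memLp j l).1, hW.integral_sq, hW.integral_sq, sq]

theorem integral_mul_pow_four_le_of_ne (hW : HasIndepEntries P v Γ W) (hij : i ≠ j) (l : q) :
    ∫ ω, (W ω i l * W ω j l) ^ 4 ∂P ≤ (Γ * v ^ 2) ^ 2 := by
  have h4 (i : p) : 0 ≤ ∫ ω, W ω i l ^ 4 ∂P := integral_nonneg fun ω => by positivity
  simp only [mul_pow _ _ 4]
  rw [integral_pow_mul_pow_of_indepFun (hW.indepFun_of_ne_left hij l l) (hW.memLp i l).1
    (hW.memLp j l).1, sq]
  exact mul_le_mul (hW.integral_pow_four_le i l) (hW.integral_pow_four_le j l) (h4 j)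
    ((h4 i).trans (hW.integral_pow_four_le i l))

theorem indepFun_sum_mul (hW : HasIndepEntries P v Γ W) (i j : p) {s : Finset q} {l : q}
    (hl : l ∉ s) :
    IndepFun (fun ω => W ω i l * W ω j l) (fun ω => ∑ l' ∈ s, W ω i l' * W ω j l') P := by
  classical
  refine indepFun_of_dependsOn hW.iIndepFun (fun e => (hW.memLp e.1 e.2).1.aemeasurable)
    (S := {i, j} ×ˢ {l}) (T := {i, j} ×ˢ s)
    (f := fun x => x (i, l) * x (j, l)) (g := fun x => ∑ l' ∈ s, x (i, l') * x (j, l'))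
    (Finset.disjoint_product.2 (Or.inr (Finset.disjoint_singleton_left.2 hl)))
    (by fun_prop) (by fun_prop) (fun x y hxy => ?_) fun x y hxy => ?_
  · exact congr_arg₂ (· * ·) (hxy (i, l) (by simp)) (hxy (j, l) (by simp))
  · exact Finset.sum_congr rfl fun l' hl' =>
      congr_arg₂ (· * ·) (hxy (i, l') (by simp [hl'])) (hxy (j, l') (by simp [hl']))

end Rows

section OffDiagonal

variable [Fintype q] {i j : p}

theorem memLp_mul_transpose_of_ne (hW : HasIndepEntries P v Γ W) (hij : i ≠ j) :
    MemLp (fun ω => (W ω * (W ω)ᵀ) i j) 4 P :=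
  memLp_finsetSum _ fun l _ => hW.memLp_mul_of_ne hij l

theorem indepFun_mul_transpose [DecidableEq p] (hW : HasIndepEntries P v Γ W) {i' j' : p}
    (hi' : i' ∉ ({i, j} : Finset p)) (hj' : j' ∉ ({i, j} : Finset p)) :
    IndepFun (fun ω => (W ω * (W ω)ᵀ) i j) (fun ω => (W ω * (W ω)ᵀ) i' j') P := by
  have hdisj : Disjoint ({i, j} : Finset p) {i', j'} := by
    simp only [Finset.disjoint_insert_right, Finset.disjoint_singleton_right]
    exact ⟨hi', hj'⟩
  refine indepFun_of_dependsOn hW.iIndepFun (fun e => (hW.memLp e.1 e.2).1.aemeasurable)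
    (S := {i, j} ×ˢ Finset.univ) (T := {i', j'} ×ˢ Finset.univ)
    (f := fun x => ∑ l, x (i, l) * x (j, l)) (g := fun x => ∑ l, x (i', l) * x (j', l))
    (Finset.disjoint_product.2 (Or.inl hdisj))
    (by fun_prop) (by fun_prop) (fun x y hxy => ?_) fun x y hxy => ?_
  all_goals exact Finset.sum_congr rfl fun l _ =>
    congr_arg₂ (· * ·) (hxy (_, l) (by simp)) (hxy (_, l) (by simp))

variable [IsProbabilityMeasure P]

theorem integral_mul_transpose_sq_of_ne (hW : HasIndepEntries P v Γ W) (hij : i ≠ j) :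
    ∫ ω, (W ω * (W ω)ᵀ) i j ^ 2 ∂P = Fintype.card q * v ^ 2 := by
  simp only [Matrix.mul_apply, Matrix.transpose_apply]
  rw [integral_sum_sq_of_pairwise_indepFun _
    (fun l => (hW.memLp_mul_of_ne hij l).mono_exponent (by norm_num)) (hW.integral_mul_of_ne hij)
    fun l l' hl => by simpa using hW.indepFun_sum_mul i j (s := {l'}) (by simpa using hl)]
  simp [hW.integral_mul_sq_of_ne hij]

theorem integral_mul_transpose_pow_four_le_of_ne (hW : HasIndepEntries P v Γ W) (hij : i ≠ j) :
    ∫ ω, (W ω * (W ω)ᵀ) i j ^ 4 ∂P ≤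
      (Fintype.card q * Γ ^ 2 + 3 * (Fintype.card q : ℝ) ^ 2) * v ^ 4 := by
  have hsum : ∑ l, ∫ ω, (W ω i l * W ω j l) ^ 4 ∂P ≤ Fintype.card q * (Γ * v ^ 2) ^ 2 := by
    rw [← nsmul_eq_mul]
    exact Finset.sum_le_card_nsmul _ _ _ fun l _ => hW.integral_mul_pow_four_le_of_ne hij l
  have hfour := integral_sum_pow_four_le Finset.univ (fun l => hW.memLp_mul_of_ne hij l)
    (hW.integral_mul_of_ne hij) fun s l hl => hW.indepFun_sum_mul i j hl
  simp only [hW.integral_mul_sq_of_ne hij, Finset.sum_const, Finset.card_univ, nsmul_eq_mul]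
    at hfour
  simp only [Matrix.mul_apply, Matrix.transpose_apply]
  linarith

theorem variance_mul_transpose_sq_le_of_ne (hW : HasIndepEntries P v Γ W) (hij : i ≠ j) :
    variance (fun ω => (W ω * (W ω)ᵀ) i j ^ 2) P ≤
      (Fintype.card q * Γ ^ 2 + 3 * (Fintype.card q : ℝ) ^ 2) * v ^ 4 := by
  refine (variance_le_expectation_sq ((hW.memLp_mul_transpose_of_ne hij).1.pow 2)).trans ?_
  simpa only [Pi.pow_apply, ← pow_mul] using hW.integral_mul_transpose_pow_four_le_of_ne hij

variable [Fintype p]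

theorem integral_sum_offDiag_sq_le (hW : HasIndepEntries P v Γ W) :
    ∫ ω, ∑ e ∈ (Finset.univ : Finset p).offDiag, (W ω * (W ω)ᵀ) e.1 e.2 ^ 2 ∂P ≤
      (Fintype.card p : ℝ) ^ 2 * (Fintype.card q * v ^ 2) := by
  have hne (e : p × p) (he : e ∈ (Finset.univ : Finset p).offDiag) : e.1 ≠ e.2 :=
    (Finset.mem_offDiag.1 he).2.2
  rw [integral_finsetSum _ fun e he => ((hW.memLp_mul_transpose_of_ne (hne e he)).mono_exponent
    (q := 4) (p := 2) (by norm_num)).integrable_sq,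
    Finset.sum_congr rfl fun e he => hW.integral_mul_transpose_sq_of_ne (hne e he),
    Finset.sum_const, nsmul_eq_mul]
  gcongr
  exact_mod_cast card_offDiag_univ_le p

theorem variance_sum_offDiag_sq_le (hW : HasIndepEntries P v Γ W) :
    variance (fun ω => ∑ e ∈ (Finset.univ : Finset p).offDiag, (W ω * (W ω)ᵀ) e.1 e.2 ^ 2) P ≤
      (Fintype.card p : ℝ) ^ 2 * (4 * Fintype.card p *
        ((Fintype.card q * Γ ^ 2 + 3 * (Fintype.card q : ℝ) ^ 2) * v ^ 4)) := by
  classical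
  have hne (e : p × p) (he : e ∈ (Finset.univ : Finset p).offDiag) : e.1 ≠ e.2 :=
    (Finset.mem_offDiag.1 he).2.2
  have hL2 (e : p × p) (he : e ∈ (Finset.univ : Finset p).offDiag) :
      MemLp (fun ω => (W ω * (W ω)ᵀ) e.1 e.2 ^ 2) 2 P :=
    memLp_two_sq_of_memLp_four (hW.memLp_mul_transpose_of_ne (hne e he))
  let sharing (e : p × p) : Finset (p × p) := {e.1, e.2} ×ˢ Finset.univ ∪ Finset.univ ×ˢ {e.1, e.2}
  have hsharing (e : p × p) : (sharing e).card ≤ 4 * Fintype.card p := by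
    have hpair : ({e.1, e.2} : Finset p).card ≤ 2 := Finset.card_le_two
    refine (Finset.card_union_le _ _).trans ?_
    rw [Finset.card_product, Finset.card_product, Finset.card_univ]
    nlinarith
  have hsum := variance_sum_le_of_covariance_le hL2
    (fun e he => hW.variance_mul_transpose_sq_le_of_ne (hne e he)) sharing
    (fun e _ => hsharing e) fun e he f hf hef => by
      simp only [sharing, Finset.mem_union, Finset.mem_product, Finset.mem_univ, and_true,
        true_and, not_or] at hef
      exact ((hW.indepFun_mul_transpose hef.1 hef.2).comp (measurable_id.pow_const 2)
        (measurable_id.pow_const 2)).covariance_eq_zero (hL2 e he) (hL2 f hf)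
  have hcard : ((Finset.univ : Finset p).offDiag.card : ℝ) ≤ (Fintype.card p : ℝ) ^ 2 :=
    mod_cast card_offDiag_univ_le p
  rw [Nat.cast_mul, Nat.cast_ofNat] at hsum
  simpa only [Finset.sum_fn] using hsum.trans (by gcongr)

end OffDiagonal

end HasIndepEntries
end IndepEntries

section Concentration

theorem frobNorm_sq_eq_sum_diag_add_sum_offDiag {p : Type*} [Fintype p] (M : Matrix p p ℝ) :
    frobNorm M ^ 2 =
      ∑ i, M i i ^ 2 + ∑ e ∈ (Finset.univ : Finset p).offDiag, M e.1 e.2 ^ 2 := by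
  classical
  rw [frobNorm_sq, ← Finset.sum_product', ← Finset.diag_union_offDiag,
    Finset.sum_union (Finset.disjoint_diag_offDiag _), Finset.sum_diag]

section SumSubSq

variable {ι : Type*} [Fintype ι] {x : ι → ℝ} {μ : ℝ}
  (hx : ∑ i, (x i - μ) ^ 2 ≤ Fintype.card ι * μ ^ 2 / 16)
include hx

theorem le_sum_of_sum_sub_sq_le (hμ : 0 ≤ μ) : 3 / 4 * (Fintype.card ι * μ) ≤ ∑ i, x i := by
  have hcauchy : (∑ i, (x i - μ)) ^ 2 ≤ Fintype.card ι * ∑ i, (x i - μ) ^ 2 :=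
    sq_sum_le_card_mul_sum_sq
  have habs : |∑ i, (x i - μ)| ≤ Fintype.card ι * μ / 4 := by
    refine abs_le_of_sq_le_sq (hcauchy.trans ?_) (by positivity)
    calc (Fintype.card ι : ℝ) * ∑ i, (x i - μ) ^ 2
        ≤ Fintype.card ι * (Fintype.card ι * μ ^ 2 / 16) := by gcongr
      _ = (Fintype.card ι * μ / 4) ^ 2 := by ring
  have hsum : ∑ i, (x i - μ) = ∑ i, x i - Fintype.card ι * μ := by
    simp [Finset.sum_sub_distrib]
  linarith [(abs_le.1 habs).1]

theorem sum_sq_le_of_sum_sub_sq_le : ∑ i, x i ^ 2 ≤ 3 * (Fintype.card ι * μ ^ 2) := by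
  have hpoint (i : ι) : x i ^ 2 ≤ 2 * (x i - μ) ^ 2 + 2 * μ ^ 2 := by
    linarith [sq_nonneg (x i - 2 * μ)]
  calc ∑ i, x i ^ 2 ≤ ∑ i, (2 * (x i - μ) ^ 2 + 2 * μ ^ 2) :=
        Finset.sum_le_sum fun i _ => hpoint i
    _ = 2 * ∑ i, (x i - μ) ^ 2 + Fintype.card ι * (2 * μ ^ 2) := by
        simp [Finset.sum_add_distrib, Finset.mul_sum]
    _ ≤ 3 * (Fintype.card ι * μ ^ 2) := by
        have : 0 ≤ (Fintype.card ι : ℝ) * μ ^ 2 := by positivity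
        linarith

end SumSubSq

variable {m k : ℕ} {v : ℝ}

theorem bounds_of_rows_firstCols_offDiag (hv : 0 ≤ v) (U : Matrix.orthogonalGroup (Fin k) ℝ)
    {r : ℕ} {M : Matrix (Fin m) (Fin k) ℝ}
    (hrows : ∑ i, ((M * Mᵀ) i i - k * v) ^ 2 ≤ m * (k * v) ^ 2 / 16)
    (hfirst : frobNorm (firstCols r (M * (U : Matrix (Fin k) (Fin k) ℝ))) ^ 2 ≤ m * k * v / 4)
    (hoff : ∑ e ∈ (Finset.univ : Finset (Fin m)).offDiag, (M * Mᵀ) e.1 e.2 ^ 2 ≤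
      2 * (m ^ 2 * k * v ^ 2)) :
    m * k * v / 2 ≤ frobNorm (lastCols r (M * (U : Matrix (Fin k) (Fin k) ℝ))) ^ 2 ∧
      frobNorm (M * Mᵀ) ^ 2 ≤ 3 * (m * k * (m + k) * v ^ 2) := by
  have hdev : ∑ i, ((M * Mᵀ) i i - k * v) ^ 2 ≤ Fintype.card (Fin m) * (k * v) ^ 2 / 16 := by
    simpa only [Fintype.card_fin] using hrows
  have hdiag := le_sum_of_sum_sub_sq_le hdev (by positivity)
  have hdiag_sq := sum_sq_le_of_sum_sub_sq_le hdev
  rw [Fintype.card_fin] at hdiag hdiag_sq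
  constructor
  · simp only [mul_transpose_self_apply_self, ← frobNorm_sq] at hdiag
    rw [← frobNorm_mul_orthogonal M U, ← frobNorm_lastCols_sq_add_firstCols_sq r] at hdiag
    linarith
  · rw [frobNorm_sq_eq_sum_diag_add_sum_offDiag]
    have : 0 ≤ (m : ℝ) ^ 2 * k * v ^ 2 := by positivity
    linarith

namespace HasIndepEntries

variable {Ω : Type*} [MeasurableSpace Ω] {P : Measure Ω} [IsProbabilityMeasure P] {Γ : ℝ}
  {W : Ω → Matrix (Fin m) (Fin k) ℝ}

theorem measureReal_rows_deviation_le (hW : HasIndepEntries P v Γ W) (hm : 0 < m) (hk : 0 < k)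
    (hv : 0 < v) :
    P.real {ω | m * (k * v) ^ 2 / 16 ≤ ∑ i, ((W ω * (W ω)ᵀ) i i - k * v) ^ 2} ≤
      16 * Γ / k := by
  have h := hW.measureReal_sum_mul_transpose_diag_sub_sq_ge_le
    (δ := m * (k * v) ^ 2 / 16) (by positivity)
  simp only [Fintype.card_fin] at h
  refine h.trans_eq ?_
  field_simp

theorem measureReal_firstCols_ge_le (hW : HasIndepEntries P v Γ W) (hm : 0 < m) (hk : 0 < k)
    (hv : 0 < v) (U : Matrix.orthogonalGroup (Fin k) ℝ) (r : ℕ) :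
    P.real {ω | m * k * v / 4 ≤
      frobNorm (firstCols r (W ω * (U : Matrix (Fin k) (Fin k) ℝ))) ^ 2} ≤ 4 * r / k := by
  refine (measureReal_ge_le_integral_div (E := m * (v * r))
    (hW.integrable_frobNorm_mul_sq (firstCols r (U : Matrix (Fin k) (Fin k) ℝ)))
    (fun ω => sq_nonneg _) ?_ (by positivity)).trans_eq ?_
  · rw [hW.integral_frobNorm_mul_sq, Fintype.card_fin]
    gcongr
    exact frobNorm_firstCols_orthogonal_sq_le r U
  · field_simp

theorem measureReal_sum_offDiag_ge_le (hW : HasIndepEntries P v Γ W) (hm : 0 < m) (hk : 0 < k)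
    (hv : 0 < v) :
    P.real {ω | 2 * (m ^ 2 * k * v ^ 2) ≤
      ∑ e ∈ (Finset.univ : Finset (Fin m)).offDiag, (W ω * (W ω)ᵀ) e.1 e.2 ^ 2} ≤
      (4 * Γ ^ 2 / k + 12) / m := by
  have hE := hW.integral_sum_offDiag_sq_le
  have hV := hW.variance_sum_offDiag_sq_le
  simp only [Fintype.card_fin, ← mul_assoc] at hE hV
  have hL2 : MemLp (fun ω => ∑ e ∈ (Finset.univ : Finset (Fin m)).offDiag,
      (W ω * (W ω)ᵀ) e.1 e.2 ^ 2) 2 P := memLp_finsetSum _ fun e he =>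
    memLp_two_sq_of_memLp_four (hW.memLp_mul_transpose_of_ne (Finset.mem_offDiag.1 he).2.2)
  have h := measureReal_add_le_variance_div_sq (δ := m ^ 2 * k * v ^ 2) hL2 hE hV (by positivity)
  rw [← two_mul] at h
  refine h.trans_eq ?_
  field_simp
  ring

theorem one_sub_le_measureReal_concentration (hW : HasIndepEntries P v Γ W) (hm : 0 < m)
    (hk : 0 < k) (hv : 0 < v) (U : Matrix.orthogonalGroup (Fin k) ℝ) (r : ℕ) :
    1 - (16 * Γ / k + 4 * r / k + (4 * Γ ^ 2 / k + 12) / m) ≤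
      P.real {ω |
        m * k * v / 2 ≤ frobNorm (lastCols r (W ω * (U : Matrix (Fin k) (Fin k) ℝ))) ^ 2 ∧
        frobNorm (W ω * (W ω)ᵀ) ^ 2 ≤ 3 * (m * k * (m + k) * v ^ 2)} := by
  set good := {ω |
    m * k * v / 2 ≤ frobNorm (lastCols r (W ω * (U : Matrix (Fin k) (Fin k) ℝ))) ^ 2 ∧
    frobNorm (W ω * (W ω)ᵀ) ^ 2 ≤ 3 * (m * k * (m + k) * v ^ 2)}
  set rows := {ω | m * (k * v) ^ 2 / 16 ≤ ∑ i, ((W ω * (W ω)ᵀ) i i - k * v) ^ 2} with hrows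
  set first := {ω | m * k * v / 4 ≤
    frobNorm (firstCols r (W ω * (U : Matrix (Fin k) (Fin k) ℝ))) ^ 2} with hfirst
  set off := {ω | 2 * (m ^ 2 * k * v ^ 2) ≤
    ∑ e ∈ (Finset.univ : Finset (Fin m)).offDiag, (W ω * (W ω)ᵀ) e.1 e.2 ^ 2} with hoff
  have hcover : goodᶜ ⊆ rows ∪ first ∪ off := fun ω hω => by
    by_contra hbad
    simp only [hrows, hfirst, hoff, Set.mem_union, Set.mem_ofPred_eq, not_or, not_le] at hbad
    obtain ⟨⟨hr, hf⟩, ho⟩ := hbad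
    exact hω (bounds_of_rows_firstCols_offDiag hv.le U hr.le hf.le ho.le)
  have htotal : 1 ≤ P.real good + P.real goodᶜ := by
    simpa using measureReal_union_le (μ := P) good goodᶜ
  have hbound : P.real goodᶜ ≤ P.real rows + P.real first + P.real off :=
    (measureReal_mono hcover).trans <| (measureReal_union_le _ _).trans <|
      add_le_add (measureReal_union_le _ _) le_rfl
  linarith [hW.measureReal_rows_deviation_le hm hk hv,
    hW.measureReal_firstCols_ge_le hm hk hv U r, hW.measureReal_sum_offDiag_ge_le hm hk hv]

end HasIndepEntries

end Concentration

section Gaussian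

theorem integral_pow_four_gaussianReal (v : ℝ≥0) :
    ∫ x, x ^ 4 ∂gaussianReal 0 v = (∫ x, x ^ 4 ∂gaussianReal 0 1) * (v : ℝ) ^ 2 := by
  have hmap : gaussianReal 0 v = (gaussianReal 0 1).map (fun x => √(v : ℝ) * x) := by
    rw [gaussianReal_map_const_mul, mul_zero, mul_one]
    congr 1
    exact NNReal.eq (Real.sq_sqrt v.coe_nonneg).symm
  have hsqrt : √(v : ℝ) ^ 4 = (v : ℝ) ^ 2 := by
    rw [← Real.sq_sqrt v.coe_nonneg, ← pow_mul, Real.sqrt_sq (Real.sqrt_nonneg _)]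
  rw [hmap, integral_map (by fun_prop) (by fun_prop)]
  simp only [mul_pow, hsqrt, integral_const_mul]
  exact mul_comm _ _

theorem IsGaussianMatrix.hasIndepEntries {Ω : Type*} [MeasurableSpace Ω] {P : Measure Ω} {m k : ℕ}
    {v : ℝ≥0} {W : Ω → Matrix (Fin m) (Fin k) ℝ} (hW : IsGaussianMatrix P v W) :
    HasIndepEntries P v (∫ x, x ^ 4 ∂gaussianReal 0 1) W := by
  have hcomp (n : ℕ) (i : Fin m) (j : Fin k) :
      ∫ ω, W ω i j ^ n ∂P = ∫ x, x ^ n ∂gaussianReal 0 v := by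
    rw [← (hW.1 i j).map_eq, integral_map (hW.1 i j).aemeasurable (by fun_prop)]
  refine ⟨fun i j => ?_, fun i j => ?_, fun i j => ?_, fun i j => ?_, hW.2⟩
  · have h4 := memLp_id_gaussianReal' (μ := 0) (v := v) 4 (by norm_num)
    rw [← (hW.1 i j).map_eq] at h4
    exact (memLp_map_measure_iff aestronglyMeasurable_id (hW.1 i j).aemeasurable).1 h4
  · simpa using hcomp 1 i j
  · rw [hcomp 2, ← variance_of_integral_eq_zero (X := fun x => x) (by fun_prop) (by simp),
      variance_fun_id_gaussianReal]
  · rw [hcomp 4, integral_pow_four_gaussianReal]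

end Gaussian

section Limit

theorem eventually_div_rpow_le (a : ℝ) {u ε : ℝ} (hu : 0 < u) (hε : 0 < ε) :
    ∀ᶠ d : ℕ in atTop, a / (d : ℝ) ^ u ≤ ε :=
  (tendsto_const_nhds.div_atTop ((tendsto_rpow_atTop hu).comp
    tendsto_natCast_atTop_atTop)).eventually (eventually_le_nhds hε)

theorem mul_le_nuclearRank_mul_conjDiagonal {m k r : ℕ} {U : Matrix.orthogonalGroup (Fin k) ℝ}
    {f : Fin k → ℝ} {a C v s : ℝ} (ha : 0 < a) (hC : 0 < C) (hf : ∀ j, |f j| ≤ C)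
    (hf' : ∀ j : Fin k, r ≤ (j : ℕ) → a ≤ |f j|) (hv : 0 < v) (hs : 0 < s) (hm : s ≤ m) (hk : s ≤ k)
    {W : Matrix (Fin m) (Fin k) ℝ}
    (hlast : m * k * v / 2 ≤ frobNorm (lastCols r (W * (U : Matrix (Fin k) (Fin k) ℝ))) ^ 2)
    (hgram : frobNorm (W * Wᵀ) ^ 2 ≤ 3 * (m * k * (m + k) * v ^ 2)) :
    (a / C) ^ 4 / 24 * s ≤ nuclearRank (W * conjDiagonal U f) := by
  have hm0 : (0 : ℝ) < m := hs.trans_le hm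
  have hk0 : (0 : ℝ) < k := hs.trans_le hk
  have hharmonic : s / 2 ≤ m * k / (m + k) := by
    rw [le_div_iff₀ (by positivity)]
    nlinarith
  calc (a / C) ^ 4 / 24 * s = (a / C) ^ 4 / 12 * (s / 2) := by ring
    _ ≤ (a / C) ^ 4 / 12 * (m * k / (m + k)) := by gcongr
    _ = (a ^ 2 * (m * k * v / 2)) ^ 2 / (C ^ 4 * (3 * (m * k * (m + k) * v ^ 2))) := by
        field_simp
        norm_num
    _ ≤ nuclearRank (W * conjDiagonal U f) :=
        div_le_nuclearRank_mul_conjDiagonal ha hC.le hf hf' W (by positivity) hlast hgram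

theorem eventually_failure_le {κ : ℝ} (hκ : 0 < κ) (Γ : ℝ) {ρ : ℕ → ℝ}
    (hρ : Tendsto ρ atTop (𝓝 0)) {ε : ℝ} (hε : 0 < ε) :
    ∀ᶠ d : ℕ in atTop, ∀ m k r : ℕ, κ * d ≤ m → κ * d ≤ k → (r : ℝ) ≤ ρ d * d →
      16 * Γ / k + 4 * r / k + (4 * Γ ^ 2 / k + 12) / m ≤ ε := by
  have hlim : Tendsto (fun d : ℕ => (16 * |Γ| + 4 * Γ ^ 2 + 12) / κ / (d : ℝ) + 4 * ρ d / κ)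
      atTop (𝓝 0) := by
    simpa using (tendsto_const_nhds.div_atTop tendsto_natCast_atTop_atTop).add
      ((hρ.const_mul 4).div_const κ)
  filter_upwards [hlim.eventually (eventually_le_nhds hε), eventually_gt_atTop 0] with d hd hd0
    m k r hm hk hr
  have hd0' : (0 : ℝ) < κ * d := by positivity
  have hk0 : (0 : ℝ) < k := hd0'.trans_le hk
  have hk1 : (1 : ℝ) ≤ k := mod_cast Nat.cast_pos.1 hk0
  refine le_trans ?_ hd
  calc 16 * Γ / k + 4 * r / k + (4 * Γ ^ 2 / k + 12) / m
      ≤ 16 * |Γ| / (κ * d) + 4 * (ρ d * d) / (κ * d) + (4 * Γ ^ 2 + 12) / (κ * d) := by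
        have hρd : 0 ≤ ρ d * d := r.cast_nonneg.trans hr
        have hΓ : 16 * Γ / k ≤ 16 * |Γ| / (κ * d) := by
          gcongr
          exact le_abs_self Γ
        gcongr
        exact div_le_self (by positivity) hk1
    _ = (16 * |Γ| + 4 * Γ ^ 2 + 12) / κ / (d : ℝ) + 4 * ρ d / κ := by
        field_simp
        ring

end Limit

end MultiSpike
end

open MultiSpike in
theorem mainTheorem5_general (c₁ c₂ c ℓ u : ℝ) (hc₁ : 0 < c₁) (hc₁₂ : c₁ ≤ c₂) (hc : 1 ≤ c)
    (hu : 0 < u) :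
    ∃ C₁ : ℝ, 0 < C₁ ∧ ∀ C₂ : ℝ,
      (∃ a b : ℝ, 0 < a ∧ 0 < b ∧ ∀ᶠ d : ℕ in atTop,
        ∀ (m k n r : ℕ) (A : Matrix (Fin k) (Fin n) ℝ) (W : Matrix (Fin m) (Fin k) ℝ)
          (U : Matrix (Fin k) (Fin k) ℝ),
          MultiSpiked c₁ c₂ ℓ u d r (gram A) → c₁ * (d : ℝ) ^ u ≤ opNorm (gram A) →
          IsOrderedEigenbasis (gram A) U → ∀ t : ℕ, InWindow C₁ C₂ ℓ u d t →
            a * nucNorm (lastCols r (W * U)) ≤ nucNorm (gradAt c A W t) ∧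
              frobNorm (gradAt c A W t) ≤
                b * (frobNorm (lastCols r (W * U)) + √(r : ℝ) * opNorm W)) ∧
      (∀ κ : ℝ, 0 < κ → ∃ C₃ : ℝ, 0 < C₃ ∧
        ∀ (Γ : ℝ) (ρ : ℕ → ℝ), Tendsto ρ atTop (𝓝 0) → ∀ ε : ℝ, 0 < ε → ∀ᶠ d : ℕ in atTop,
          ∀ (m k n r : ℕ) (A : Matrix (Fin k) (Fin n) ℝ),
            κ * d ≤ m → κ * d ≤ k → (r : ℝ) ≤ ρ d * d →
            MultiSpiked c₁ c₂ ℓ u d r (gram A) → c₁ * (d : ℝ) ^ u ≤ opNorm (gram A) →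
            ∀ (Ω : Type*) [MeasurableSpace Ω] (P : Measure Ω) [IsProbabilityMeasure P]
              (W : Ω → Matrix (Fin m) (Fin k) ℝ) (v : ℝ), 0 < v → HasIndepEntries P v Γ W →
              1 - ε ≤ P.real {ω | ∀ t : ℕ, InWindow C₁ C₂ ℓ u d t →
                C₃ * d ≤ nuclearRank (gradAt c A (W ω) t)}) := by
  have hc₂ : 0 < c₂ := hc₁.trans_le hc₁₂
  refine ⟨2 * c * c₂ * u / c₁, by positivity, fun C₂ => ?_⟩
  set a := c₁ * Real.exp (-(2 * (c₂ / (c * c₁) * C₂)))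
  have ha : 0 < a := by positivity
  have hlarge := eventually_div_rpow_le (c₂ / (c * c₁)) hu one_half_pos
  refine ⟨⟨a, 2 * c₂, ha, by positivity, ?_⟩, fun κ hκ =>
    ⟨(a / (2 * c₂)) ^ 4 / 24 * κ, by positivity, fun Γ ρ hρ ε hε => ?_⟩⟩
  · filter_upwards [hlarge, eventually_gt_atTop 0] with d hd' hd m k n r A W U hA hop hU t ht
    obtain ⟨V, lam, rfl, hlam, hB⟩ := hU.exists_eq_conjDiagonal
    obtain ⟨f, hf, hf', hgrad⟩ :=
      exists_gradAt_eq_mul_conjDiagonal hc₁ hc₂ hc hu.le hd hd' hA hop hlam hB ht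
    rw [hgrad]
    exact ⟨mul_nucNorm_lastCols_le ha hf' W, frobNorm_mul_conjDiagonal_le (by positivity) hf W⟩
  · filter_upwards [hlarge, eventually_gt_atTop 0, eventually_failure_le hκ Γ hρ hε] with
      d hd' hd hfail m k n r A hm hk hr hA hop Ω _ P _ W v hv hW
    obtain ⟨U, hU⟩ := exists_isOrderedEigenbasis (gram_isHermitian A)
    obtain ⟨V, lam, rfl, hlam, hB⟩ := hU.exists_eq_conjDiagonal
    have hd0 : (0 : ℝ) < κ * d := by positivity
    have hconc := hW.one_sub_le_measureReal_concentration (Nat.cast_pos.1 (hd0.trans_le hm))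
      (Nat.cast_pos.1 (hd0.trans_le hk)) hv V r
    refine (sub_le_sub_left (hfail m k r hm hk hr) 1).trans (hconc.trans (measureReal_mono ?_))
    rintro ω ⟨hlast, hgram⟩ t ht
    obtain ⟨f, hf, hf', hgrad⟩ :=
      exists_gradAt_eq_mul_conjDiagonal hc₁ hc₂ hc hu.le hd hd' hA hop hlam hB ht
    rw [hgrad, mul_assoc]
    exact mul_le_nuclearRank_mul_conjDiagonal ha (by positivity) hf hf' hv hd0 hm hk hlast hgram

theorem mainTheorem5 (c₁ c₂ c ℓ u : ℝ) (hc₁ : 0 < c₁) (hc₁₂ : c₁ ≤ c₂) (hc : 1 ≤ c)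
    (hℓ : 0 < ℓ) (hu : 0 < u) :
    ∃ C₁ : ℝ, 0 < C₁ ∧ ∀ C₂ : ℝ, 0 < C₂ →
      -- the two deterministic estimates
      (∀ K : ℝ, ∃ a b : ℝ, 0 < a ∧ 0 < b ∧ ∀ᶠ d : ℕ in atTop,
        ∀ (m k n r : ℕ) (A : Matrix (Fin k) (Fin n) ℝ) (Wsharp : Matrix (Fin m) (Fin k) ℝ)
          (U : Matrix (Fin k) (Fin k) ℝ),
          MultiSpike.MultiSpiked c₁ c₂ ℓ u d r (MultiSpike.gram A) →
          c₁ * (d : ℝ) ^ u ≤ MultiSpike.opNorm (MultiSpike.gram A) →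
          MultiSpike.opNorm Wsharp ≤ K →
          MultiSpike.IsOrderedEigenbasis (MultiSpike.gram A) U →
          ∀ t : ℕ, MultiSpike.InWindow C₁ C₂ ℓ u d t →
            a * (MultiSpike.nucNorm (MultiSpike.lastCols r (Wsharp * U)) - r) ≤
                MultiSpike.nucNorm (MultiSpike.gradAt c A Wsharp t) ∧
              MultiSpike.frobNorm (MultiSpike.gradAt c A Wsharp t) ≤
                b * (MultiSpike.frobNorm (MultiSpike.lastCols r (Wsharp * U)) + √(r : ℝ))) ∧
      -- Gaussian ground truth, for fixed `A`, with `m ≍ k ≍ d` and `r = o(d)`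
      (∀ κ₁ κ₂ : ℝ, 0 < κ₁ → ∃ C₃ : ℝ, 0 < C₃ ∧
        ∀ ρ : ℕ → ℝ, Tendsto ρ atTop (𝓝 0) → ∀ ε : ℝ, 0 < ε → ∀ᶠ d : ℕ in atTop,
          ∀ (m k n r : ℕ) (A : Matrix (Fin k) (Fin n) ℝ),
            κ₁ * d ≤ m → (m : ℝ) ≤ κ₂ * d → κ₁ * d ≤ k → (k : ℝ) ≤ κ₂ * d →
            (r : ℝ) ≤ ρ d * d →
            MultiSpike.MultiSpiked c₁ c₂ ℓ u d r (MultiSpike.gram A) →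
            c₁ * (d : ℝ) ^ u ≤ MultiSpike.opNorm (MultiSpike.gram A) →
            ∀ (Ω : Type*) [MeasurableSpace Ω] (P : Measure Ω) [IsProbabilityMeasure P]
              (W : Ω → Matrix (Fin m) (Fin k) ℝ),
              MultiSpike.IsGaussianMatrix P (1 / (d : ℝ≥0)) W →
              1 - ε ≤ P.real {ω | ∀ t : ℕ, MultiSpike.InWindow C₁ C₂ ℓ u d t →
                C₃ * d ≤ MultiSpike.nuclearRank (MultiSpike.gradAt c A (W ω) t)}) := by
  obtain ⟨C₁, hC₁, hgen⟩ := mainTheorem5_general c₁ c₂ c ℓ u hc₁ hc₁₂ hc hu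
  refine ⟨C₁, hC₁, fun C₂ _ => ⟨fun K => ?_, fun κ₁ κ₂ hκ₁ => ?_⟩⟩
  · obtain ⟨a, b, ha, hb, hbounds⟩ := (hgen C₂).1
    refine ⟨a, b * (|K| + 1), ha, by positivity, hbounds.mono
      fun d hd m k n r A W U hA hop hW hU t ht => ?_⟩
    obtain ⟨hnuc, hfrob⟩ := hd m k n r A W U hA hop hU t ht
    refine ⟨(mul_le_mul_of_nonneg_left (sub_le_self _ r.cast_nonneg) ha.le).trans hnuc,
      hfrob.trans ?_⟩
    rw [mul_assoc]
    gcongr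
    nlinarith [MultiSpike.frobNorm_nonneg (MultiSpike.lastCols r (W * U)), Real.sqrt_nonneg (r : ℝ),
      abs_nonneg K, le_abs_self K]
  · obtain ⟨C₃, hC₃, hprob⟩ := (hgen C₂).2 κ₁ hκ₁
    refine ⟨C₃, hC₃, fun ρ hρ ε hε => ?_⟩
    filter_upwards [hprob (∫ x, x ^ 4 ∂gaussianReal 0 1) ρ hρ ε hε, eventually_gt_atTop 0] with
      d hd hd0 m k n r A hm _ hk _ hr hA hop Ω _ P _ W hW
    exact hd m k n r A hm hk hr hA hop Ω P W _ (by positivity) hW.hasIndepEntries
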